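/- **Theorem 1.2 (Private Preconditioning).** A randomized algorithm $M$ taking $n$ points of $\mathbb{R}^d$ is $\rho$-zCDP if $D_\alpha(M(X)\,\|\,M(X'))\le\rho\alpha$ for all $\alpha>1$ and all $X,X'\in(\mathbb{R}^d)^n$ that differ in at most one entry, where $D_\alpha$ is the Rényi divergence of order $\alpha$. For absolute constants $a,b,K>0$ and parameters $\rho,\beta,\kappa$, let $\mathrm{PPC}_{\rho,\beta,\kappa}$ be the following algorithm, run on $X_1,\dots,X_n\in\mathbb{R}^d$. Let $T$ be the least natural number with $0.7^{T}\kappa\le 1000$, let $\rho'=\rho/T$, $\beta'=\beta/T$, and $B_0=\mathbb{I}$. For $t=1,\dots,T$, put $\kappa_t=0.7^{\,t-1}\kappa$ and $Y_i=B_{t-1}X_i$, and run $\mathrm{WeakPPC}_{\rho',\beta',\kappa_t}$ on $Y_1,\dots,Y_n$: - form the matrix $\frac1n\sum_i Y_iY_i^{\top}$, where the sum is over those $i$ with $\|Y_i\|_2^2\le a\,d\,\kappa_t\log(n/\beta')$; - add a fresh random symmetric matrix whose entries on and above the diagonal are i.i.d. $N(0,s^2)$ with $s=b\,d\,\kappa_t\log(n/\beta')/(n\sqrt{\rho'})$,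 and project the result to the positive semidefinite matrices, obtaining $Z$; - let $V$ be the span of the eigenvectors of $Z$ with eigenvalue at least $\kappa_t/2$, and return $\tilde A_t=K^{-1/2}\Pi_V+\Pi_{V^\perp}$. Put $B_t=1.1\,\tilde A_t\,B_{t-1}$. After the last round output $A=(B_T^{\top}B_T)^{1/2}$. There are absolute constants $a,b,K,C>0$ and $c\in\mathbb{N}$ such that the number of rounds satisfies $T\le C\log\kappa$ for every $\kappa\ge1$, and such that for all $d,n\in\mathbb{N}$, $\varepsilon>0$, $\beta\in(0,1)$ and $\kappa\ge 1$ the following hold. 1. $\mathrm{PPC}_{\varepsilon^2/2,\beta,\kappa}$ on datasets of $n$ points of $\mathbb{R}^d$ is $\frac{\varepsilon^2}{2}$-zCDP. 2. If $\varepsilon\le\sqrt d$ (in particular if $\varepsilon\le 1\le d$) and $$ n\;\ge\; C\,\frac{d^{3/2}\log^{1/2}\kappa}{\varepsilon}\,\log^{c}\!\Big(e+d+\frac1\varepsilon+\log\kappa+\frac1\beta\Big), $$ then for every $\Sigma\in\mathbb{R}^{d\times d}$ with $\mathbb{I}\preceq\Sigma\preceq\kappa\mathbb{I}$, when $X_1,\dots,X_n$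 are i.i.d. samples from $N(0,\Sigma)$, with probability at least $1-\beta$ over the samples and the algorithm's randomness, $\mathrm{PPC}_{\varepsilon^2/2,\beta,\kappa}$ outputs a symmetric matrix $A$ such that $\mathbb{I}\preceq A\Sigma A\preceq 1000\,\mathbb{I}$. -/

import Mathlib

open MeasureTheory ProbabilityTheory

noncomputable section

/-- Datasets of `n` points of `ℝᵈ`. -/
abbrev Dataset (n d : ℕ) : Type := Fin n → EuclideanSpace ℝ (Fin d)

/-- Real `d × d` matrices. -/
abbrev Mat (d : ℕ) : Type := Matrix (Fin d) (Fin d) ℝ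

/-- The Borel (equivalently, the entrywise product) σ-algebra on matrices. -/
instance Mat.instMeasurableSpace (d : ℕ) : MeasurableSpace (Mat d) :=
  inferInstanceAs (MeasurableSpace (Fin d → Fin d → ℝ))

/-! ### Concentrated differential privacy -/

/-- Two datasets are neighbouring if they differ on at most a single entry. -/
def Neighboring {n : ℕ} {𝒳 : Type*} (X X' : Fin n → 𝒳) : Prop :=
  {i | X i ≠ X' i}.Subsingleton

/-- The Rényi divergence of order `α > 1`,
`D_α(P‖Q) = (α - 1)⁻¹ log ∫ (dP/dQ)^α dQ` if `P ≪ Q`, and `+∞` otherwise. -/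
def renyiDiv {Ω : Type*} [MeasurableSpace Ω] (α : ℝ) (P Q : Measure Ω) : EReal :=
  open Classical in
  if P ≪ Q then (((α - 1)⁻¹ : ℝ) : EReal) * ENNReal.log (∫⁻ x, (P.rnDeriv Q x) ^ α ∂Q) else ⊤

/-- A randomized algorithm `M`, given as a Markov kernel from datasets to outputs,
is `ρ`-zCDP. -/
def IsZCDP {n : ℕ} {𝒳 𝒴 : Type*} [MeasurableSpace 𝒳] [MeasurableSpace 𝒴]
    (M : Kernel (Fin n → 𝒳) 𝒴) (ρ : ℝ) : Prop :=
  ∀ X X' : Fin n → 𝒳, Neighboring X X' → ∀ α : ℝ, 1 < α →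
    renyiDiv α (M X) (M X') ≤ ((ρ * α : ℝ) : EReal)

/-! ### Private preconditioning -/

/-- The random symmetric matrix `GUE(s²)`: its entries on and above the diagonal are i.i.d.
`N(0, s²)`. -/
def gue (d : ℕ) (s : ℝ) : Measure (Mat d) :=
  (Measure.pi fun _ : Fin d => Measure.pi fun _ : Fin d => gaussianReal 0 (s ^ 2).toNNReal).map
    fun g => Matrix.of fun i j => g (min i j) (max i j)

/-- The sum `(1/n) ∑ Xᵢ Xᵢᵀ` over those `i` with `‖Xᵢ‖² ≤ r`. -/
def truncCov {n d : ℕ} (r : ℝ) (X : Dataset n d) : Mat d :=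
  open Classical in
  (1 / (n : ℝ)) • ∑ i : Fin n,
    if ‖X i‖ ^ 2 ≤ r then Matrix.vecMulVec (X i : Fin d → ℝ) (X i : Fin d → ℝ) else 0

/-- The positive part of a symmetric matrix, obtained by replacing every negative eigenvalue by
`0`; this is its Frobenius-nearest positive semidefinite matrix. -/
def psdProj {d : ℕ} (M : Mat d) : Mat d := cfc (fun x : ℝ => max x 0) M

/-- The law of the output of naive private covariance estimation `NaivePCE_{ρ,β,κ}(X)`: discard
the points of squared norm more than `a d κ log (n/β)`, form the empirical covariance, add
`GUE(s²)` noise with `s = b d κ log (n/β) / (n √ρ)`, and project to the positive semidefinite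
matrices. -/
def naivePCE {n d : ℕ} (a b ρ β κ : ℝ) (X : Dataset n d) : Measure (Mat d) :=
  (gue d (b * (d * κ * Real.log (n / β) / (n * Real.sqrt ρ)))).map fun N =>
    psdProj (truncCov (a * (d * κ * Real.log (n / β))) X + N)

/-- For symmetric `Z`, the matrix `K^(-1/2) Π_V + Π_{V^⊥}`, where `V` is the span of the
eigenvectors of `Z` with eigenvalue at least `κ/2`. -/
def precond {d : ℕ} (K κ : ℝ) (Z : Mat d) : Mat d :=
  cfc (fun x : ℝ => if κ / 2 ≤ x then 1 / Real.sqrt K else 1) Z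

/-- The law of the matrix returned by `WeakPPC_{ρ,β,κ,K}(X)`. -/
def weakPPC {n d : ℕ} (a b K ρ β κ : ℝ) (X : Dataset n d) : Measure (Mat d) :=
  (naivePCE a b ρ β κ X).map (precond K κ)

/-- The dataset `B X₁, …, B Xₙ`. -/
def transform {n d : ℕ} (B : Mat d) (X : Dataset n d) : Dataset n d :=
  fun i => WithLp.toLp 2 (B.mulVec (X i : Fin d → ℝ))

/-- The law of the accumulated product `B = A⁽ᵗ⁾ ⋯ A⁽¹⁾` after `t` rounds of recursive
preconditioning. In round `t + 1`, `weakPPC` is run with fresh noise on the current data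
`B X₁, …, B Xₙ` with the current bound `κ⁽ᵗ⁺¹⁾ = 0.7ᵗ κ`, and `B` is multiplied on the left by
`A⁽ᵗ⁺¹⁾`, which is `1.1` times the outcome. -/
def ppcLoop {n d : ℕ} (a b K ρ β κ : ℝ) (X : Dataset n d) : ℕ → Measure (Mat d)
  | 0 => Measure.dirac 1
  | t + 1 => (ppcLoop a b K ρ β κ X t).bind fun B =>
      (weakPPC a b K ρ β ((7 / 10) ^ t * κ) (transform B X)).map fun A => ((11 / 10 : ℝ) • A) * B

/-- The number of rounds: the least `T` with `0.7ᵀ κ ≤ 1000`. -/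
def ppcRounds (κ : ℝ) : ℕ := ⌈Real.log (κ / 1000) / Real.log (10 / 7)⌉₊

/-- The law of the output of the recursive private preconditioner `PPC_{ρ,β,κ}(X)`: run
`T = ppcRounds κ` rounds, each with privacy parameter `ρ/T` and failure parameter `β/T`, and
return the symmetric factor `(Bᵀ B)^{1/2}` in the polar decomposition of the product
`B = A⁽ᵀ⁾ ⋯ A⁽¹⁾`. -/
def ppc {n d : ℕ} (a b K ρ β κ : ℝ) (X : Dataset n d) : Measure (Mat d) :=
  (ppcLoop a b K (ρ / ppcRounds κ) (β / ppcRounds κ) κ X (ppcRounds κ)).map fun B =>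
    cfc Real.sqrt (B.transpose * B)

/-- `A` is symmetric and `I ⪯ A S A ⪯ 1000 I`. -/
def IsPreconditioner {d : ℕ} (S A : Mat d) : Prop :=
  A.IsSymm ∧ (A * S * A - 1).PosSemidef ∧ ((1000 : ℝ) • (1 : Mat d) - A * S * A).PosSemidef

end

/-! Privacy. A Rényi bound of order α is dual to an inequality E_P φ ≤ e^c ‖φ‖_{L^q(Q)} for all φ ≥
0, with q conjugate to α. In this form post-processing is a substitution, and adaptive composition
(`HolderBound.bind`) needs no densities: the outer bound is applied to the inner L^q norm. Densities
enter only for a single Gaussian (`HolderBound.gaussianReal`) and in the return to Rényi divergence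
(`HolderBound.renyiDiv_le`). Replacing one point moves the truncated covariance by at most 2r/n in
Frobenius norm, so each round costs at most ρ/T, and the T costs add up.

Accuracy. Write the samples as R Wᵢ with R = Σ^{1/2} and Wᵢ standard Gaussian. A single event on W
is used: the empirical covariance is within 1/300 of the identity and no Wᵢ is long. In any round
the data are B R Wᵢ, with covariance A = BΣBᵀ = (BR)(BR)ᵀ. The event therefore gives relative
accuracy 1/300 and no truncation for all admissible B at once, although B was chosen adaptively from
the same samples. The noise is fresh and has operator norm at most κ/300 with high probability; the
projection costs another κ/300. Hence Z is within κ/100 of A.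

Halving the directions where Z is at least κ/2, then scaling by 1.1, turns I ⪯ A ⪯ κI into bounds 1
and 0.7κ (`FormBounds.precond_mul_mul`): the large directions have room to shrink, and the factor
1.1 pays for the cross terms. After T rounds the upper bound is at most 1000, and the polar factor
differs from B only by an orthogonal matrix on the left. The failure probability is β/2 for the
samples plus T·(β/T)/2 for the noise.

The noise has norm of order κ d log(n/β') √(T(d + log(1/β')))/(nε), with β' = β/T. The factor κ
cancels against the tolerance κ/300, which leaves d^{3/2} √(log κ)/ε up to logarithms
(`sampleSize_bounds`). -/

noncomputable section

/-! ### Rényi divergence by duality -/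

/-- The dual (Hölder) form of a bound on the Rényi divergence: the expectation under `P` of every
nonnegative function is at most `exp c` times its `L^q` norm under `Q`. -/
def HolderBound {Ω : Type*} [MeasurableSpace Ω] (q c : ℝ) (P Q : Measure Ω) : Prop :=
  ∀ φ : Ω → ENNReal, Measurable φ →
    ∫⁻ x, φ x ∂P ≤ ENNReal.ofReal (Real.exp c) * (∫⁻ x, φ x ^ q ∂Q) ^ (1 / q)

namespace HolderBound

variable {Ω Ω' : Type*} [MeasurableSpace Ω] [MeasurableSpace Ω'] {q c c' : ℝ} {P Q : Measure Ω}

theorem refl [IsProbabilityMeasure P] (hq : 1 < q) : HolderBound q 0 P P := by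
  intro φ hφ
  have h := ENNReal.lintegral_mul_le_Lp_mul_Lq P (Real.HolderConjugate.conjExponent hq)
    hφ.aemeasurable (aemeasurable_const (b := (1 : ENNReal)))
  simpa using h

theorem mono (h : HolderBound q c P Q) (hc : c ≤ c') : HolderBound q c' P Q := fun φ hφ =>
  (h φ hφ).trans (by gcongr)

theorem map (h : HolderBound q c P Q) {f : Ω → Ω'} (hf : Measurable f) :
    HolderBound q c (P.map f) (Q.map f) := by
  intro φ hφ
  rw [lintegral_map hφ hf, lintegral_map (hφ.pow_const _) hf]
  exact h _ (hφ.comp hf)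

/-- Use the inner bound at each x, then the outer bound on the test function x ↦ ‖φ‖_{L^q(η x)}. Its
q-th power integrates to the iterated integral, so the constants multiply with no loss. -/
theorem bind (hq : 0 < q) (h : HolderBound q c P Q) {κ η : Ω → Measure Ω'} (hκ : Measurable κ)
    (hη : Measurable η) (hκη : ∀ x, HolderBound q c' (κ x) (η x)) :
    HolderBound q (c + c') (P.bind κ) (Q.bind η) := by
  intro φ hφ
  rw [Measure.lintegral_bind hκ.aemeasurable hφ.aemeasurable,
    Measure.lintegral_bind hη.aemeasurable (hφ.pow_const _).aemeasurable]
  have hm : Measurable fun x => ∫⁻ y, φ y ^ q ∂η x :=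
    (Measure.measurable_lintegral (hφ.pow_const q)).comp hη
  calc ∫⁻ x, ∫⁻ y, φ y ∂κ x ∂P
      ≤ ∫⁻ x, ENNReal.ofReal (Real.exp c') * (∫⁻ y, φ y ^ q ∂η x) ^ (1 / q) ∂P :=
        lintegral_mono fun x => hκη x φ hφ
    _ = ENNReal.ofReal (Real.exp c') * ∫⁻ x, (∫⁻ y, φ y ^ q ∂η x) ^ (1 / q) ∂P :=
        lintegral_const_mul _ (hm.pow_const _)
    _ ≤ ENNReal.ofReal (Real.exp c') * (ENNReal.ofReal (Real.exp c) *
          (∫⁻ x, ((∫⁻ y, φ y ^ q ∂η x) ^ (1 / q)) ^ q ∂Q) ^ (1 / q)) := by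
        gcongr
        exact h _ (hm.pow_const _)
    _ = _ := by
        simp only [← ENNReal.rpow_mul, one_div, inv_mul_cancel₀ hq.ne', ENNReal.rpow_one]
        rw [← mul_assoc, ← ENNReal.ofReal_mul (Real.exp_pos _).le, ← Real.exp_add, add_comm c']

theorem prod {P' Q' : Measure Ω'} [SFinite P'] [SFinite Q'] (hq : 0 < q) (h : HolderBound q c P Q)
    (h' : HolderBound q c' P' Q') : HolderBound q (c + c') (P.prod P') (Q.prod Q') := by
  rw [Measure.prod_def, Measure.prod_def]
  exact h.bind hq Measurable.map_prodMk_left Measurable.map_prodMk_left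
    fun _ => h'.map measurable_prodMk_left

theorem pi {n : ℕ} {Ω : Fin n → Type*} [∀ i, MeasurableSpace (Ω i)] {P Q : ∀ i, Measure (Ω i)}
    [∀ i, IsProbabilityMeasure (P i)] [∀ i, IsProbabilityMeasure (Q i)] {c : Fin n → ℝ}
    (hq : 1 < q) (h : ∀ i, HolderBound q (c i) (P i) (Q i)) :
    HolderBound q (∑ i, c i) (Measure.pi P) (Measure.pi Q) := by
  induction n with
  | zero =>
    have : Measure.pi P = Measure.pi Q := by
      rw [Measure.pi_of_empty P, Measure.pi_of_empty Q]
    rw [this]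
    simpa using refl hq
  | succ n ih =>
    have hP := (measurePreserving_piFinSuccAbove P 0).symm
    have hQ := (measurePreserving_piFinSuccAbove Q 0).symm
    rw [← hP.map_eq, ← hQ.map_eq, Fin.sum_univ_succ]
    exact ((h 0).prod (by linarith) (ih fun i => h _)).map (MeasurableEquiv.measurable _)

theorem absolutelyContinuous (hq : 0 < q) (h : HolderBound q c P Q) : P ≪ Q := by
  refine Measure.AbsolutelyContinuous.mk fun s hs hs0 => ?_
  have := h (s.indicator 1) (measurable_one.indicator hs)
  have h2 : ∀ x, (s.indicator (1 : Ω → ENNReal) x) ^ q = s.indicator 1 x := by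
    intro x
    by_cases hx : x ∈ s <;> simp [hx, hq]
  simp only [h2, lintegral_indicator_one hs, hs0] at this
  simpa [hq] using this

/-- Test the bound on f^(α-1) with f = dP/dQ. Since (α-1)q = α, the integral I of f^α satisfies I ≤
e^c I^(1/q), and cancelling gives I^(1/α) ≤ e^c. Truncating f at n makes I finite, so that
cancelling is legitimate; monotone convergence removes the truncation. -/
theorem lintegral_rnDeriv_rpow_le [IsFiniteMeasure P] [IsFiniteMeasure Q] {α : ℝ}
    (hα : α.HolderConjugate q) (h : HolderBound q c P Q) :
    ∫⁻ x, P.rnDeriv Q x ^ α ∂Q ≤ ENNReal.ofReal (Real.exp (α * c)) := by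
  set f := P.rnDeriv Q with hf
  have hfm : Measurable f := Measure.measurable_rnDeriv P Q
  have hα1 : 1 < α := hα.lt
  have hq0 : 0 < q := hα.symm.pos
  have hPQ := h.absolutelyContinuous hq0
  have key : ∀ n : ℕ, ∫⁻ x, (min (f x) n) ^ α ∂Q ≤ ENNReal.ofReal (Real.exp (α * c)) := by
    intro n
    have hgm : Measurable fun x => min (f x) (n : ENNReal) := hfm.min measurable_const
    set I := ∫⁻ x, (min (f x) n) ^ α ∂Q with hI
    have hIfin : I ≠ ⊤ := by
      have : I ≤ ∫⁻ _, (n : ENNReal) ^ α ∂Q := lintegral_mono fun x => by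
        gcongr
        exact min_le_right _ _
      refine (this.trans_lt ?_).ne
      rw [lintegral_const]
      exact ENNReal.mul_lt_top (ENNReal.rpow_lt_top_of_nonneg (by linarith) (by simp))
        (measure_lt_top _ _)
    have h1 : I ≤ ENNReal.ofReal (Real.exp c) * I ^ (1 / q) := by
      calc I ≤ ∫⁻ x, f x * (min (f x) n) ^ (α - 1) ∂Q := by
            refine lintegral_mono fun x => ?_
            have : (min (f x) (n : ENNReal)) ^ α
                = min (f x) n * (min (f x) n) ^ (α - 1) := by
              conv_lhs => rw [show α = 1 + (α - 1) by ring]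
              rw [ENNReal.rpow_add_of_nonneg _ _ (by norm_num) (by linarith), ENNReal.rpow_one]
            rw [this]
            gcongr
            exact min_le_left _ _
        _ = ∫⁻ x, (min (f x) n) ^ (α - 1) ∂P :=
            lintegral_rnDeriv_mul hPQ (hgm.pow_const _).aemeasurable
        _ ≤ ENNReal.ofReal (Real.exp c) * (∫⁻ x, ((min (f x) n) ^ (α - 1)) ^ q ∂Q) ^ (1 / q) :=
            h _ (hgm.pow_const _)
        _ = _ := by simp only [← ENNReal.rpow_mul, hα.sub_one_mul_conj, hI]
    by_cases hI0 : I = 0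
    · simp [hI0]
    have hIq0 : I ^ (1 / q) ≠ 0 := by simp [hI0, hIfin]
    have hIqt : I ^ (1 / q) ≠ ⊤ := ENNReal.rpow_ne_top_of_nonneg (by positivity) hIfin
    have h2 : I ^ (1 / α) ≤ ENNReal.ofReal (Real.exp c) := by
      have h3 : I = I ^ (1 / α) * I ^ (1 / q) := by
        rw [← ENNReal.rpow_add _ _ hI0 hIfin, one_div, one_div, hα.inv_add_inv_eq_one,
          ENNReal.rpow_one]
      rw [h3] at h1
      conv at h1 => rhs; rw [← h3]
      exact (ENNReal.mul_le_mul_iff_left hIq0 hIqt).1 h1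
    calc I = (I ^ (1 / α)) ^ α := by
          rw [← ENNReal.rpow_mul, one_div, inv_mul_cancel₀ (by linarith), ENNReal.rpow_one]
      _ ≤ (ENNReal.ofReal (Real.exp c)) ^ α := by gcongr
      _ = _ := by
          rw [ENNReal.ofReal_rpow_of_pos (Real.exp_pos _), ← Real.exp_mul, mul_comm]
  have hmono : ∫⁻ x, f x ^ α ∂Q = ⨆ n : ℕ, ∫⁻ x, (min (f x) n) ^ α ∂Q := by
    rw [← lintegral_iSup]
    · refine lintegral_congr fun x => ?_
      refine (le_antisymm (iSup_le fun n => ?_) ?_).symm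
      · gcongr
        exact min_le_left _ _
      · by_cases hx : f x = ⊤
        · simp only [hx, min_eq_right le_top]
          rw [ENNReal.top_rpow_of_pos (by linarith), top_le_iff, iSup_eq_top]
          intro b hb
          obtain ⟨n, hn⟩ := ENNReal.exists_nat_gt hb.ne
          refine ⟨n + 1, hn.trans_le ?_⟩
          have h1 : (1 : ENNReal) ≤ ((n + 1 : ℕ) : ENNReal) := by simp
          calc (n : ENNReal) ≤ ((n + 1 : ℕ) : ENNReal) := by simp
            _ = ((n + 1 : ℕ) : ENNReal) ^ (1 : ℝ) := by simp
            _ ≤ _ := ENNReal.rpow_le_rpow_of_exponent_le h1 hα1.le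
        · obtain ⟨n, hn⟩ := ENNReal.exists_nat_gt hx
          refine le_iSup_of_le n ?_
          rw [min_eq_left hn.le]
    · exact fun n => (hfm.min measurable_const).pow_const _
    · intro m n hmn x
      dsimp only
      gcongr
  rw [hmono]
  exact iSup_le key

theorem renyiDiv_le [IsFiniteMeasure P] [IsFiniteMeasure Q] {α : ℝ}
    (hα : α.HolderConjugate q) (h : HolderBound q c P Q) :
    renyiDiv α P Q ≤ (((α - 1)⁻¹ * (α * c) : ℝ) : EReal) := by
  have hpos : 0 < (α - 1)⁻¹ := inv_pos.2 (sub_pos.2 hα.lt)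
  rw [renyiDiv, if_pos (h.absolutelyContinuous hα.symm.pos), EReal.coe_mul]
  refine mul_le_mul_of_nonneg_left ?_ (by exact_mod_cast hpos.le)
  have := ENNReal.log_monotone (h.lintegral_rnDeriv_rpow_le hα)
  refine this.trans (le_of_eq ?_)
  rw [ENNReal.log_ofReal_of_pos (Real.exp_pos _), Real.log_exp]

/-- Hölder's inequality against the explicit density ratio f. The α-th moment of f is exact: f^α
times the density of N(ν, v) is a multiple of the density of N(ν + α(μ - ν), v). -/
theorem gaussianReal (μ ν : ℝ) {v : NNReal} (hv : v ≠ 0) {α : ℝ} (hα : α.HolderConjugate q) :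
    HolderBound q ((α - 1) * (μ - ν) ^ 2 / (2 * v)) (gaussianReal μ v) (gaussianReal ν v) := by
  intro φ hφ
  have hv' : (0 : ℝ) < v := by positivity
  set f : ℝ → ENNReal := fun x =>
    ENNReal.ofReal (Real.exp (((x - ν) ^ 2 - (x - μ) ^ 2) / (2 * v))) with hf
  have hfm : Measurable f := by fun_prop
  have hden : ∀ x, gaussianPDF μ v x = gaussianPDF ν v x * f x := by
    intro x
    rw [gaussianPDF, gaussianPDF, hf, ← ENNReal.ofReal_mul (gaussianPDFReal_nonneg _ _ _),
      gaussianPDFReal, gaussianPDFReal, mul_assoc (_⁻¹), ← Real.exp_add]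
    congr 3
    ring
  have hpow : ∫⁻ x, f x ^ α ∂(ProbabilityTheory.gaussianReal ν v)
      = ENNReal.ofReal (Real.exp (α * ((α - 1) * (μ - ν) ^ 2 / (2 * v)))) := by
    rw [gaussianReal_of_var_ne_zero _ hv,
      lintegral_withDensity_eq_lintegral_mul _ (measurable_gaussianPDF ν v) (hfm.pow_const _)]
    have : ∀ x, (gaussianPDF ν v * fun x => f x ^ α) x
        = ENNReal.ofReal (Real.exp (α * ((α - 1) * (μ - ν) ^ 2 / (2 * v)))) *
          gaussianPDF (ν + α * (μ - ν)) v x := by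
      intro x
      simp only [Pi.mul_apply, hf]
      rw [ENNReal.ofReal_rpow_of_pos (Real.exp_pos _), ← Real.exp_mul, gaussianPDF, gaussianPDF,
        ← ENNReal.ofReal_mul (gaussianPDFReal_nonneg _ _ _), ← ENNReal.ofReal_mul
        (Real.exp_pos _).le, gaussianPDFReal, gaussianPDFReal, mul_assoc, mul_left_comm
        (Real.exp _), ← Real.exp_add, ← Real.exp_add]
      congr 3
      field_simp
      ring
    simp_rw [this]
    rw [lintegral_const_mul _ (measurable_gaussianPDF _ _), lintegral_gaussianPDF_eq_one _ hv,
      mul_one]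
  calc ∫⁻ x, φ x ∂(ProbabilityTheory.gaussianReal μ v)
      = ∫⁻ x, f x * φ x ∂(ProbabilityTheory.gaussianReal ν v) := by
        rw [gaussianReal_of_var_ne_zero _ hv, gaussianReal_of_var_ne_zero _ hv,
          lintegral_withDensity_eq_lintegral_mul _ (measurable_gaussianPDF _ v) hφ,
          lintegral_withDensity_eq_lintegral_mul _ (measurable_gaussianPDF ν v)
            (g := fun x => f x * φ x) (hfm.mul hφ)]
        refine lintegral_congr fun x => ?_
        simp only [Pi.mul_apply, hden, mul_assoc]
    _ ≤ (∫⁻ x, f x ^ α ∂(ProbabilityTheory.gaussianReal ν v)) ^ (1 / α) *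
          (∫⁻ x, φ x ^ q ∂(ProbabilityTheory.gaussianReal ν v)) ^ (1 / q) :=
        ENNReal.lintegral_mul_le_Lp_mul_Lq _ hα hfm.aemeasurable hφ.aemeasurable
    _ = _ := by
        rw [hpow, ENNReal.ofReal_rpow_of_pos (Real.exp_pos _), ← Real.exp_mul]
        congr 3
        have := hα.pos.ne'
        field_simp

end HolderBound

/-! ### Measurability of the matrix functional calculus -/

open Filter Topology in
theorem TendstoUniformlyOn.of_finite {α β ι : Type*} [UniformSpace β] {F : ι → α → β} {f : α → β}
    {l : Filter ι} {s : Set α} (hs : s.Finite) (h : ∀ x ∈ s, Tendsto (fun i => F i x) l (𝓝 (f x))) :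
    TendstoUniformlyOn F f l s := by
  intro u hu
  refine (Filter.eventually_all_finite hs).2 fun x hx => ?_
  exact (Uniform.tendsto_nhds_right.1 (h x hx)) hu

instance Mat.instBorelSpace (d : ℕ) : BorelSpace (Mat d) :=
  inferInstanceAs (BorelSpace (Fin d → Fin d → ℝ))

instance Mat.instSecondCountableTopology (d : ℕ) : SecondCountableTopology (Mat d) :=
  inferInstanceAs (SecondCountableTopology (Fin d → Fin d → ℝ))

instance Mat.instPseudoMetrizableSpace (d : ℕ) : TopologicalSpace.PseudoMetrizableSpace (Mat d) :=
  inferInstanceAs (TopologicalSpace.PseudoMetrizableSpace (Fin d → Fin d → ℝ))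

section cfc

variable {d : ℕ}

theorem measurableSet_isSelfAdjoint : MeasurableSet {M : Mat d | IsSelfAdjoint M} :=
  (isClosed_eq (by fun_prop) continuous_id).measurableSet

-- A matrix has finite spectrum, so pointwise convergence of functions is uniform there and the
-- functional calculus passes to the limit.
open Filter Topology in
theorem measurable_cfc_of_tendsto {F : ℕ → ℝ → ℝ} {f : ℝ → ℝ}
    (hF : ∀ k, Measurable fun M : Mat d => cfc (F k) M)
    (h : ∀ x, Tendsto (fun k => F k x) atTop (𝓝 (f x))) : Measurable fun M : Mat d => cfc f M := by
  refine measurable_of_tendsto_metrizable (f := fun k M => cfc (F k) M) hF ?_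
  rw [tendsto_pi_nhds]
  intro M
  refine tendsto_cfc_fun (TendstoUniformlyOn.of_finite M.finite_real_spectrum fun x _ => h x) ?_
  exact Eventually.of_forall fun k => M.finite_real_spectrum.continuousOn _

open Filter Topology in
theorem measurable_cfc_of_continuous {f : ℝ → ℝ} (hf : Continuous f) :
    Measurable fun M : Mat d => cfc f M := by
  have h : ∀ k : ℕ, ∃ p : Polynomial ℝ, ∀ x ∈ Set.Icc (-(k : ℝ)) k,
      |p.eval x - f x| < 1 / ((k : ℝ) + 1) := fun k =>
    exists_polynomial_near_of_continuousOn _ _ f hf.continuousOn _ (by positivity)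
  choose p hp using h
  refine measurable_cfc_of_tendsto (F := fun k => (p k).eval) (fun k => ?_) fun x => ?_
  -- The functional calculus is 0 off the self-adjoint matrices, hence the indicator of a closed
  -- set.
  · have : (fun M : Mat d => cfc (p k).eval M)
        = {M : Mat d | IsSelfAdjoint M}.indicator fun M => Polynomial.aeval M (p k) := by
      ext1 M
      by_cases hM : IsSelfAdjoint M
      · rw [cfc_polynomial _ _ hM, Set.indicator_of_mem (by exact hM)]
      · rw [cfc_apply_of_not_predicate _ hM, Set.indicator_of_notMem (by exact hM)]
    rw [this]
    exact Measurable.indicator (p k).continuous_aeval.measurable measurableSet_isSelfAdjoint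
  · rw [tendsto_iff_dist_tendsto_zero]
    refine squeeze_zero' (Eventually.of_forall fun _ => dist_nonneg) ?_
      tendsto_one_div_add_atTop_nhds_zero_nat
    filter_upwards [eventually_ge_atTop ⌈|x|⌉₊] with k hk
    have : |x| ≤ k := (Nat.le_ceil _).trans (by exact_mod_cast hk)
    exact (hp k x (abs_le.1 this)).le

theorem measurable_psdProj : Measurable (psdProj (d := d)) :=
  measurable_cfc_of_continuous (by fun_prop)

-- The threshold function is discontinuous, but it is the pointwise limit of ramps of width 1/k. The
-- ramps end at κ/2 itself, so that the threshold belongs to the shrunk side.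
open Filter Topology in
theorem measurable_precond (K κ : ℝ) : Measurable (precond (d := d) K κ) := by
  refine measurable_cfc_of_tendsto
    (F := fun k x => 1 + (1 / √K - 1) * max 0 (min 1 (1 + k * (x - κ / 2))))
    (fun k => measurable_cfc_of_continuous (by fun_prop)) fun x => ?_
  apply tendsto_const_nhds.congr'
  split_ifs with hx
  · refine Eventually.of_forall fun k => ?_
    dsimp only
    have : 0 ≤ (k : ℝ) * (x - κ / 2) := mul_nonneg k.cast_nonneg (by linarith)
    rw [min_eq_left (by linarith), max_eq_right zero_le_one, mul_one, add_sub_cancel]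
  · push Not at hx
    obtain ⟨m, hm⟩ := exists_nat_gt (1 / (κ / 2 - x))
    filter_upwards [eventually_ge_atTop m] with k hk
    have h1 : 1 < (m : ℝ) * (κ / 2 - x) := (div_lt_iff₀ (by linarith)).1 hm
    have h2 : (m : ℝ) * (κ / 2 - x) ≤ k * (κ / 2 - x) := by
      have : (m : ℝ) ≤ k := by exact_mod_cast hk
      gcongr
    rw [max_eq_left ((min_le_right _ _).trans (by linarith)), mul_zero, add_zero]

end cfc

/-! ### The algorithm as a Markov kernel -/

section kernels

variable {n d : ℕ}

theorem measurable_mat_iff {Ω : Type*} [MeasurableSpace Ω] {f : Ω → Mat d} :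
    Measurable f ↔ ∀ i j, Measurable fun x => f x i j := by
  exact (measurable_pi_iff (X := fun _ : Fin d => Fin d → ℝ) (g := f)).trans
    (forall_congr' fun i => measurable_pi_iff)

@[fun_prop]
theorem measurable_transform : Measurable fun p : Mat d × Dataset n d => transform p.1 p.2 := by
  refine measurable_pi_lambda _ fun i => ?_
  refine (WithLp.measurable_toLp 2 _).comp (measurable_pi_lambda _ fun j => ?_)
  simp only [Matrix.mulVec, dotProduct]
  refine Finset.measurable_sum _ fun k _ => ?_
  have h1 : Measurable fun p : Mat d × Dataset n d => p.1 j k :=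
    (measurable_mat_iff.1 measurable_fst) j k
  have h2 : Measurable fun p : Mat d × Dataset n d => p.2 i k := by fun_prop
  exact h1.mul h2

@[fun_prop]
theorem measurable_truncCov (r : ℝ) : Measurable (truncCov (n := n) (d := d) r) := by
  refine measurable_mat_iff.2 fun i j => ?_
  simp only [truncCov, Matrix.smul_apply, Matrix.sum_apply, smul_eq_mul]
  refine (Finset.measurable_sum _ fun k _ => ?_).const_mul _
  have : (fun X : Dataset n d => (if ‖X k‖ ^ 2 ≤ r then
      Matrix.vecMulVec (X k : Fin d → ℝ) (X k : Fin d → ℝ) else 0 : Mat d) i j)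
      = fun X => if ‖X k‖ ^ 2 ≤ r then X k i * X k j else 0 := by
    ext X
    split_ifs <;> simp [Matrix.vecMulVec_apply]
  rw [this]
  exact Measurable.ite (measurableSet_le (by fun_prop) (by fun_prop)) (by fun_prop) (by fun_prop)

theorem measurable_symmOfUpper : Measurable fun g : Fin d → Fin d → ℝ =>
    (Matrix.of fun i j => g (min i j) (max i j) : Mat d) :=
  measurable_mat_iff.2 fun i j => by
    simp only [Matrix.of_apply]
    fun_prop

instance gue.instIsProbabilityMeasure (s : ℝ) : IsProbabilityMeasure (gue d s) :=
  Measure.isProbabilityMeasure_map measurable_symmOfUpper.aemeasurable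

/-- One round of the recursive preconditioner as a function of the noise `N`: the accumulated
product `B` is multiplied by `1.1` times the preconditioner found on the data `B X₁, …, B Xₙ`. -/
def ppcStep (K κ r : ℝ) (X : Dataset n d) (B N : Mat d) : Mat d :=
  ((11 / 10 : ℝ) • precond K κ (psdProj (truncCov r (transform B X) + N))) * B

theorem measurable_ppcStep (K κ r : ℝ) :
    Measurable fun p : (Dataset n d × Mat d) × Mat d => ppcStep K κ r p.1.1 p.1.2 p.2 := by
  have h1 : Measurable fun p : (Dataset n d × Mat d) × Mat d =>
      truncCov r (transform p.1.2 p.1.1) := by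
    exact (measurable_truncCov r).comp (measurable_transform.comp
      (measurable_fst.snd.prodMk measurable_fst.fst))
  have h2 := ((measurable_precond K κ).comp (measurable_psdProj.comp
    (h1.add measurable_snd))).const_smul (11 / 10 : ℝ)
  exact h2.mul (by fun_prop)

theorem measurable_ppcStep_right (K κ r : ℝ) (X : Dataset n d) (B : Mat d) :
    Measurable (ppcStep K κ r X B) := by
  have h := (measurable_ppcStep (n := n) (d := d) K κ r).comp
    (measurable_prodMk_left (x := (X, B)))
  exact h

theorem weakPPC_map_eq (a b K ρ β κ : ℝ) (X : Dataset n d) (B : Mat d) :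
    ((weakPPC a b K ρ β κ (transform B X)).map fun A => ((11 / 10 : ℝ) • A) * B)
      = (gue d (b * (d * κ * Real.log (n / β) / (n * Real.sqrt ρ)))).map
          (ppcStep K κ (a * (d * κ * Real.log (n / β))) X B) := by
  have h1 : Measurable fun N : Mat d =>
      psdProj (truncCov (a * (d * κ * Real.log (n / β))) (transform B X) + N) :=
    measurable_psdProj.comp (measurable_const.add measurable_id)
  have h2 : Measurable fun A : Mat d => ((11 / 10 : ℝ) • A) * B :=
    (measurable_id.const_smul (11 / 10 : ℝ)).mul measurable_const
  rw [weakPPC, naivePCE, Measure.map_map (measurable_precond K κ) h1,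
    Measure.map_map h2 ((measurable_precond K κ).comp h1)]
  rfl

theorem measurable_map_of_uncurry {α β γ : Type*} [MeasurableSpace α] [MeasurableSpace β]
    [MeasurableSpace γ] (μ : Measure β) [SFinite μ] {F : α × β → γ} (hF : Measurable F) :
    Measurable fun a => μ.map fun b => F (a, b) := by
  have : (fun a => μ.map fun b => F (a, b)) = fun a => (μ.map (Prod.mk a)).map F := by
    ext1 a
    rw [Measure.map_map hF measurable_prodMk_left]
    rfl
  rw [this]
  exact (Measure.measurable_map F hF).comp Measurable.map_prodMk_left

theorem MeasureTheory.Measure.map_bind_eq {α β γ : Type*} [MeasurableSpace α] [MeasurableSpace β]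
    [MeasurableSpace γ] {μ : Measure α} {f : α → β} {g : β → Measure γ} (hg : Measurable g)
    (hf : Measurable f) : (μ.map f).bind g = μ.bind (g ∘ f) := by
  rw [Measure.bind, Measure.bind, Measure.map_map hg hf]

theorem measurable_weakPPC_map (a b K ρ β κ : ℝ) :
    Measurable fun p : Dataset n d × Mat d =>
      (weakPPC a b K ρ β κ (transform p.2 p.1)).map fun A => ((11 / 10 : ℝ) • A) * p.2 := by
  simp only [weakPPC_map_eq]
  exact measurable_map_of_uncurry _ (measurable_ppcStep K κ _)

theorem measurable_ppcLoop (a b K ρ β κ : ℝ) (t : ℕ) :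
    (Measurable fun X : Dataset n d => ppcLoop a b K ρ β κ X t) ∧
      ∀ X : Dataset n d, IsProbabilityMeasure (ppcLoop a b K ρ β κ X t) := by
  induction t with
  | zero => exact ⟨measurable_const, fun X => by rw [ppcLoop]; infer_instance⟩
  | succ t ih =>
    obtain ⟨ihm, ihp⟩ := ih
    have hm := measurable_weakPPC_map (n := n) (d := d) a b K ρ β ((7 / 10) ^ t * κ)
    refine ⟨?_, fun X => ?_⟩
    -- The next round reads both the data and the product so far, so X is carried along by pairing
    -- with the identity kernel.
    · let k : Kernel (Dataset n d) (Mat d) := ⟨fun X => ppcLoop a b K ρ β κ X t, ihm⟩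
      have : IsMarkovKernel k := ⟨ihp⟩
      have h : (fun X : Dataset n d => ppcLoop a b K ρ β κ X (t + 1))
          = fun X => ((Kernel.id ×ₖ k) X).bind fun p =>
            (weakPPC a b K ρ β ((7 / 10) ^ t * κ) (transform p.2 p.1)).map
              fun A => ((11 / 10 : ℝ) • A) * p.2 := by
        ext1 X
        rw [Kernel.prod_apply, Kernel.id_apply, Measure.dirac_prod,
          Measure.map_bind_eq hm measurable_prodMk_left]
        rfl
      rw [h]
      exact (Measure.measurable_bind' hm).comp (Kernel.measurable _)
    · have := ihp X
      have hX := hm.comp (measurable_prodMk_left (x := X))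
      rw [ppcLoop]
      refine isProbabilityMeasure_bind hX.aemeasurable (Filter.Eventually.of_forall fun B => ?_)
      rw [weakPPC_map_eq]
      exact Measure.isProbabilityMeasure_map (measurable_ppcStep_right _ _ _ _ _).aemeasurable

theorem measurable_polarFactor :
    Measurable fun B : Mat d => cfc Real.sqrt (B.transpose * B) := by
  refine (measurable_cfc_of_continuous Real.continuous_sqrt).comp ?_
  exact (show Continuous fun B : Mat d => B.transpose * B by fun_prop).measurable

/-- The recursive private preconditioner as a Markov kernel. -/
def ppcKernel (a b K ρ β κ : ℝ) : Kernel (Dataset n d) (Mat d) where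
  toFun X := ppc a b K ρ β κ X
  measurable' := (Measure.measurable_map _ measurable_polarFactor).comp
    (measurable_ppcLoop a b K _ _ κ _).1

instance ppcKernel.instIsMarkovKernel (a b K ρ β κ : ℝ) :
    IsMarkovKernel (ppcKernel (n := n) (d := d) a b K ρ β κ) where
  isProbabilityMeasure X := by
    have := (measurable_ppcLoop (n := n) (d := d) a b K (ρ / ppcRounds κ) (β / ppcRounds κ) κ
      (ppcRounds κ)).2 X
    exact Measure.isProbabilityMeasure_map measurable_polarFactor.aemeasurable

end kernels

/-! ### Privacy -/

section privacy

variable {n d : ℕ}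

theorem sum_vecMulVec_sq (x : EuclideanSpace ℝ (Fin d)) :
    ∑ i, ∑ j, (Matrix.vecMulVec (x : Fin d → ℝ) (x : Fin d → ℝ) i j) ^ 2 = (‖x‖ ^ 2) ^ 2 := by
  simp only [Matrix.vecMulVec_apply, mul_pow]
  rw [EuclideanSpace.real_norm_sq_eq, sq (∑ i, _), Finset.sum_mul_sum]

theorem truncCov_isSymm (r : ℝ) (X : Dataset n d) : (truncCov r X).IsSymm := by
  refine Matrix.IsSymm.ext fun i j => ?_
  simp only [truncCov, Matrix.smul_apply, Matrix.sum_apply]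
  congr 1
  refine Finset.sum_congr rfl fun k _ => ?_
  split_ifs
  · simp [Matrix.vecMulVec_apply, mul_comm]
  · simp

/-- Only one summand changes. A kept point contributes xxᵀ, of Frobenius norm ‖x‖² ≤ r, and a
discarded one contributes 0. -/
theorem sum_truncCov_sub_sq_le {r : ℝ} {X X' : Dataset n d} (h : Neighboring X X') :
    ∑ i, ∑ j, (truncCov r X i j - truncCov r X' i j) ^ 2 ≤ (2 * r / n) ^ 2 := by
  classical
  by_cases hX : X = X'
  · subst hX
    simp only [sub_self, ne_eq, OfNat.ofNat_ne_zero, not_false_eq_true, zero_pow,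
      Finset.sum_const_zero]
    positivity
  obtain ⟨k, hk⟩ := Function.ne_iff.1 hX
  set w : EuclideanSpace ℝ (Fin d) → Mat d := fun x =>
    if ‖x‖ ^ 2 ≤ r then Matrix.vecMulVec (x : Fin d → ℝ) (x : Fin d → ℝ) else 0 with hw
  have hw2 : ∀ x, ∑ i, ∑ j, (w x i j) ^ 2 ≤ r ^ 2 := by
    intro x
    by_cases hx : ‖x‖ ^ 2 ≤ r
    · simp only [hw, if_pos hx, sum_vecMulVec_sq]
      gcongr
    · simp only [hw, if_neg hx]
      simpa using sq_nonneg r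
  have htr : ∀ Y : Dataset n d, truncCov r Y = (1 / (n : ℝ)) • ∑ i, w (Y i) := by
    intro Y
    simp only [truncCov, hw]
  have hdiff : ∀ i j, truncCov r X i j - truncCov r X' i j
      = (1 / (n : ℝ)) * (w (X k) i j - w (X' k) i j) := by
    intro i j
    rw [htr, htr]
    simp only [Matrix.smul_apply, Matrix.sum_apply, smul_eq_mul]
    rw [← mul_sub, ← Finset.sum_sub_distrib, Finset.sum_eq_single k]
    · intro l _ hl
      have : X l = X' l := by
        by_contra hne
        exact hl (h hne hk)
      rw [this, sub_self]
    · simp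
  calc ∑ i, ∑ j, (truncCov r X i j - truncCov r X' i j) ^ 2
      ≤ ∑ i, ∑ j, (1 / (n : ℝ)) ^ 2 * (2 * w (X k) i j ^ 2 + 2 * w (X' k) i j ^ 2) := by
        refine Finset.sum_le_sum fun i _ => Finset.sum_le_sum fun j _ => ?_
        rw [hdiff, mul_pow]
        gcongr
        nlinarith [sq_nonneg (w (X k) i j + w (X' k) i j)]
    _ = (1 / (n : ℝ)) ^ 2 * (2 * ∑ i, ∑ j, w (X k) i j ^ 2 + 2 * ∑ i, ∑ j, w (X' k) i j ^ 2) := by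
        simp only [← Finset.mul_sum, Finset.sum_add_distrib]
    _ ≤ (1 / (n : ℝ)) ^ 2 * (2 * r ^ 2 + 2 * r ^ 2) := by
        gcongr <;> exact hw2 _
    _ = (2 * r / n) ^ 2 := by ring

/-- Adding a symmetric matrix commutes with copying the upper triangle, so the shift can be made on
d² independent Gaussians, of which those below the diagonal are dummies. -/
theorem gue_map_const_add {A : Mat d} (hA : A.IsSymm) (s : ℝ) :
    (gue d s).map (A + ·) = (Measure.pi fun i => Measure.pi fun j =>
      gaussianReal (A i j) (s ^ 2).toNNReal).map
        fun g => (Matrix.of fun i j => g (min i j) (max i j) : Mat d) := by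
  have h1 : (Measure.pi fun i => Measure.pi fun j => gaussianReal (A i j) (s ^ 2).toNNReal)
      = (Measure.pi fun _ : Fin d => Measure.pi fun _ : Fin d =>
          gaussianReal 0 (s ^ 2).toNNReal).map fun g i j => A i j + g i j := by
    have h2 : ∀ i, (Measure.pi fun j => gaussianReal (A i j) (s ^ 2).toNNReal)
        = (Measure.pi fun _ : Fin d => gaussianReal 0 (s ^ 2).toNNReal).map
          fun g j => A i j + g j := by
      intro i
      rw [Measure.pi_map_pi (f := fun j x => A i j + x) (fun j => by fun_prop)]
      simp only [gaussianReal_map_const_add, zero_add]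
    rw [Measure.pi_map_pi (f := fun i (g : Fin d → ℝ) j => A i j + g j)
      (fun i => (show Measurable fun (g : Fin d → ℝ) j => A i j + g j by fun_prop).aemeasurable)]
    simp only [h2]
  rw [h1, gue, Measure.map_map (by fun_prop) measurable_symmOfUpper,
    Measure.map_map measurable_symmOfUpper (by fun_prop)]
  congr 1
  ext1 g
  ext i j
  simp only [Function.comp_apply, Matrix.add_apply, Matrix.of_apply, add_left_inj]
  rcases le_total i j with hij | hij
  · simp [hij]
  · simp [hij, hA.apply]

theorem holderBound_gue {A A' : Mat d} (hA : A.IsSymm) (hA' : A'.IsSymm) {s : ℝ} (hs : s ≠ 0)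
    {α q : ℝ} (hα : α.HolderConjugate q) :
    HolderBound q ((α - 1) * (∑ i, ∑ j, (A i j - A' i j) ^ 2) / (2 * s ^ 2))
      ((gue d s).map (A + ·)) ((gue d s).map (A' + ·)) := by
  have hv : (s ^ 2).toNNReal ≠ 0 := by
    rw [ne_eq, Real.toNNReal_eq_zero, not_le]
    positivity
  rw [gue_map_const_add hA, gue_map_const_add hA']
  refine HolderBound.map ?_ measurable_symmOfUpper
  have hrow := fun i => HolderBound.pi hα.symm.lt fun j =>
    HolderBound.gaussianReal (A i j) (A' i j) hv hα
  have hprob : ∀ A : Mat d, ∀ i, IsProbabilityMeasure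
      (Measure.pi fun j => gaussianReal (A i j) (s ^ 2).toNNReal) := fun A i => inferInstance
  have := hprob A
  have := hprob A'
  refine (HolderBound.pi hα.symm.lt hrow).mono (le_of_eq ?_)
  simp only [← Finset.sum_div, ← Finset.mul_sum, Real.coe_toNNReal _ (sq_nonneg s)]

theorem Neighboring.transform {X X' : Dataset n d} (h : Neighboring X X') (B : Mat d) :
    Neighboring (transform B X) (_root_.transform B X') := by
  refine Set.Subsingleton.anti h fun i hi hX => hi ?_
  simp only [_root_.transform, hX]

/-- For fixed B the round is post-processing of covariance plus noise. Sensitivity 2am/n against s =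
bm/(n√ρ) costs (α-1)ρ(2a)²/(2b²), so b ≥ 2a suffices with a factor 2 to spare. -/
theorem holderBound_weakPPC_map {a b K ρ β κ : ℝ} (ha : 0 < a) (hb : 2 * a ≤ b) (hρ : 0 < ρ)
    (hκ : 0 < κ) (hn : 0 < n) (hd : 0 < d) (hlog : 0 < Real.log (n / β)) {X X' : Dataset n d}
    (h : Neighboring X X') (B : Mat d) {α q : ℝ} (hα : α.HolderConjugate q) :
    HolderBound q ((α - 1) * ρ)
      ((weakPPC a b K ρ β κ (transform B X)).map fun A => ((11 / 10 : ℝ) • A) * B)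
      ((weakPPC a b K ρ β κ (transform B X')).map fun A => ((11 / 10 : ℝ) • A) * B) := by
  rw [weakPPC_map_eq, weakPPC_map_eq]
  set m : ℝ := d * κ * Real.log (n / β) with hm
  have hm0 : 0 < m := by positivity
  have hb0 : 0 < b := by linarith
  set s : ℝ := b * (m / (n * √ρ)) with hs
  have hs0 : 0 < s := by positivity
  have h2 : Measurable fun Z : Mat d => ((11 / 10 : ℝ) • precond K κ (psdProj Z)) * B :=
      (((measurable_precond K κ).comp measurable_psdProj).const_smul (11 / 10 : ℝ)).mul
        measurable_const
  have hstep : ∀ Y : Dataset n d, (gue d s).map (ppcStep K κ (a * m) Y B)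
      = ((gue d s).map (truncCov (a * m) (transform B Y) + ·)).map
        fun Z => ((11 / 10 : ℝ) • precond K κ (psdProj Z)) * B := by
    intro Y
    rw [Measure.map_map h2 (measurable_const_add _)]
    rfl
  rw [hstep, hstep]
  refine HolderBound.map ?_ h2
  refine (holderBound_gue (truncCov_isSymm _ _) (truncCov_isSymm _ _) hs0.ne' hα).mono ?_
  have hsum := sum_truncCov_sub_sq_le (r := a * m) (h.transform B)
  have hn' : (0 : ℝ) < n := by exact_mod_cast hn
  rw [mul_div_assoc]
  refine mul_le_mul_of_nonneg_left ?_ (sub_pos.2 hα.lt).le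
  rw [div_le_iff₀ (by positivity)]
  refine hsum.trans ?_
  have hs2 : ρ * (2 * s ^ 2) = 2 * (b * m / n) ^ 2 := by
    have : √ρ ^ 2 = ρ := Real.sq_sqrt hρ.le
    rw [hs]
    field_simp
    rw [this]
  rw [hs2]
  have : 2 * (a * m) / n ≤ b * m / n := by
    rw [← mul_assoc]
    gcongr
  have h0 : 0 ≤ 2 * (a * m) / n := by positivity
  nlinarith [pow_le_pow_left₀ h0 this 2, sq_nonneg (b * m / n)]

theorem holderBound_ppcLoop {a b K ρ β κ : ℝ} (ha : 0 < a) (hb : 2 * a ≤ b) (hρ : 0 < ρ)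
    (hκ : 0 < κ) (hn : 0 < n) (hd : 0 < d) (hlog : 0 < Real.log (n / β)) {X X' : Dataset n d}
    (h : Neighboring X X') {α q : ℝ} (hα : α.HolderConjugate q) (t : ℕ) :
    HolderBound q (t * ((α - 1) * ρ)) (ppcLoop a b K ρ β κ X t) (ppcLoop a b K ρ β κ X' t) := by
  induction t with
  | zero => simpa [ppcLoop] using HolderBound.refl hα.symm.lt
  | succ t ih =>
    rw [ppcLoop, ppcLoop, Nat.cast_succ, add_mul, one_mul]
    have hm := measurable_weakPPC_map (n := n) (d := d) a b K ρ β ((7 / 10) ^ t * κ)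
    exact ih.bind hα.symm.pos (hm.comp (measurable_prodMk_left (x := X)))
      (hm.comp (measurable_prodMk_left (x := X'))) fun B =>
      holderBound_weakPPC_map ha hb hρ (by positivity) hn hd hlog h B hα

theorem isZCDP_ppcKernel {a b K ρ β κ : ℝ} (ha : 0 < a) (hb : 2 * a ≤ b) (hρ : 0 < ρ)
    (hκ : 0 < κ) (hβ : 0 < β) (hβ1 : β < 1) :
    IsZCDP (ppcKernel (n := n) (d := d) a b K ρ β κ) ρ := by
  intro X X' h α hα1
  have hα := Real.HolderConjugate.conjExponent hα1
  set q := α.conjExponent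
  suffices hB : HolderBound q ((α - 1) * ρ) (ppcKernel a b K ρ β κ X)
      (ppcKernel a b K ρ β κ X') by
    refine (hB.renyiDiv_le hα).trans (le_of_eq ?_)
    congr 1
    have : α - 1 ≠ 0 := (sub_pos.2 hα1).ne'
    field_simp
  have hnonneg : 0 ≤ (α - 1) * ρ := mul_nonneg (sub_pos.2 hα1).le hρ.le
  -- For d = 0 or n = 0 the noise scale degenerates to 0, but then the two output laws coincide.
  by_cases hd : d = 0
  · subst hd
    have : ppcKernel a b K ρ β κ X = ppcKernel a b K ρ β κ X' := by
      refine Measure.ext fun s _ => ?_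
      rcases s.eq_empty_or_nonempty with h | h
      · simp [h]
      · simp [h.eq_univ]
    rw [this]
    exact (HolderBound.refl hα.symm.lt).mono hnonneg
  by_cases hn : n = 0
  · subst hn
    rw [Subsingleton.elim X X']
    exact (HolderBound.refl hα.symm.lt).mono hnonneg
  refine HolderBound.map ?_ measurable_polarFactor
  by_cases hT : ppcRounds κ = 0
  · rw [hT, ppcLoop, ppcLoop]
    exact (HolderBound.refl hα.symm.lt).mono hnonneg
  have hT0 : (1 : ℝ) ≤ ppcRounds κ := by exact_mod_cast Nat.one_le_iff_ne_zero.2 hT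
  have hn0 : (1 : ℝ) ≤ n := by exact_mod_cast Nat.one_le_iff_ne_zero.2 hn
  have hlog : 0 < Real.log (n / (β / ppcRounds κ)) := by
    refine Real.log_pos ((one_lt_div (by positivity)).2 ?_)
    calc β / ppcRounds κ ≤ β := div_le_self hβ.le hT0
      _ < 1 := hβ1
      _ ≤ n := hn0
  refine (holderBound_ppcLoop ha hb (by positivity) hκ (Nat.pos_of_ne_zero hn)
    (Nat.pos_of_ne_zero hd) hlog h hα _).mono (le_of_eq ?_)
  field_simp

end privacy

/-! ### Quadratic forms and one exact step of preconditioning -/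

section quadraticForm

open Matrix

variable {d : ℕ}

/-- `l I ⪯ M ⪯ u I`, in terms of the quadratic form of `M`. -/
def FormBounds (l u : ℝ) (M : Mat d) : Prop :=
  ∀ x : Fin d → ℝ, l * (x ⬝ᵥ x) ≤ x ⬝ᵥ M *ᵥ x ∧ x ⬝ᵥ M *ᵥ x ≤ u * (x ⬝ᵥ x)

theorem dotProduct_self_nonneg' (x : Fin d → ℝ) : 0 ≤ x ⬝ᵥ x :=
  Finset.sum_nonneg fun i _ => mul_self_nonneg (x i)

theorem isSymm_iff_isSelfAdjoint {M : Mat d} : M.IsSymm ↔ IsSelfAdjoint M := by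
  rw [IsSelfAdjoint, star_eq_conjTranspose, conjTranspose_eq_transpose_of_trivial]
  rfl

theorem dotProduct_mulVec_comm' {M : Mat d} (hM : M.IsSymm) (x y : Fin d → ℝ) :
    x ⬝ᵥ M *ᵥ y = y ⬝ᵥ M *ᵥ x := by
  rw [dotProduct_mulVec, ← mulVec_transpose, hM.eq, dotProduct_comm]

theorem dotProduct_mulVec_eq {M : Mat d} (hM : M.IsSymm) (x y : Fin d → ℝ) :
    x ⬝ᵥ M *ᵥ y = (M *ᵥ x) ⬝ᵥ y := by
  rw [dotProduct_mulVec_comm' hM, dotProduct_comm]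

theorem FormBounds.add {l u l' u' : ℝ} {M M' : Mat d} (h : FormBounds l u M)
    (h' : FormBounds l' u' M') : FormBounds (l + l') (u + u') (M + M') := by
  intro x
  rw [add_mulVec, dotProduct_add, add_mul, add_mul]
  exact ⟨add_le_add (h x).1 (h' x).1, add_le_add (h x).2 (h' x).2⟩

theorem FormBounds.mono {l u l' u' : ℝ} {M : Mat d} (h : FormBounds l u M) (hl : l' ≤ l)
    (hu : u ≤ u') : FormBounds l' u' M := fun x =>
  ⟨(mul_le_mul_of_nonneg_right hl (dotProduct_self_nonneg' x)).trans (h x).1,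
    (h x).2.trans (mul_le_mul_of_nonneg_right hu (dotProduct_self_nonneg' x))⟩

/-- A bound on the quadratic form of a symmetric matrix bounds its bilinear form. -/
theorem FormBounds.two_mul_abs_le {c : ℝ} {M : Mat d} (hM : M.IsSymm) (h : FormBounds (-c) c M)
    (x y : Fin d → ℝ) : 2 * |x ⬝ᵥ M *ᵥ y| ≤ c * (x ⬝ᵥ x + y ⬝ᵥ y) := by
  have h1 := h (x + y)
  have h2 := h (x - y)
  have hc := dotProduct_mulVec_comm' hM x y
  have hd := dotProduct_comm x y
  simp only [mulVec_add, mulVec_sub, dotProduct_add, add_dotProduct, dotProduct_sub,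
    sub_dotProduct] at h1 h2
  rw [← hc, ← hd] at h1 h2
  have : |x ⬝ᵥ M *ᵥ y| ≤ c * (x ⬝ᵥ x + y ⬝ᵥ y) / 2 := by
    rw [abs_le]
    constructor <;> linarith [h1.1, h1.2, h2.1, h2.2]
  linarith

theorem isSymm_cfc (f : ℝ → ℝ) (M : Mat d) : (cfc f M).IsSymm :=
  isSymm_iff_isSelfAdjoint.2 (cfc_predicate f M)

theorem cfc_mul_of_finite (f g : ℝ → ℝ) (M : Mat d) :
    cfc (fun x => f x * g x) M = cfc f M * cfc g M :=
  cfc_mul f g M (M.finite_real_spectrum.continuousOn _) (M.finite_real_spectrum.continuousOn _)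

/-- The functional calculus is monotone: `f ≥ 0` on the spectrum gives a nonnegative form. -/
theorem cfc_form_nonneg {f : ℝ → ℝ} {M : Mat d} (hf : ∀ t ∈ spectrum ℝ M, 0 ≤ f t)
    (x : Fin d → ℝ) : 0 ≤ x ⬝ᵥ cfc f M *ᵥ x := by
  have h : cfc f M = cfc (fun t => √(f t)) M * cfc (fun t => √(f t)) M := by
    rw [← cfc_mul_of_finite]
    exact cfc_congr fun t ht => (Real.mul_self_sqrt (hf t ht)).symm
  rw [h, ← mulVec_mulVec, dotProduct_mulVec_eq (isSymm_cfc _ _)]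
  exact dotProduct_self_nonneg' _

theorem FormBounds.le_of_mem_spectrum {l u t : ℝ} {M : Mat d} (hM : M.IsSymm)
    (h : FormBounds l u M) (ht : t ∈ spectrum ℝ M) : l ≤ t ∧ t ≤ u := by
  have hM' : M.IsHermitian := isSymm_iff_isSelfAdjoint.1 hM
  rw [hM'.spectrum_real_eq_range_eigenvalues] at ht
  obtain ⟨i, rfl⟩ := ht
  have h1 := h (hM'.eigenvectorBasis i)
  have h2 : (hM'.eigenvectorBasis i : Fin d → ℝ) ⬝ᵥ hM'.eigenvectorBasis i = 1 := by
    have := hM'.eigenvectorBasis.orthonormal.1 i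
    have h3 := EuclideanSpace.real_norm_sq_eq (hM'.eigenvectorBasis i)
    rw [this] at h3
    simp only [dotProduct, ← sq]
    linarith
  have h3 := hM'.eigenvalues_eq i
  simp only [star_trivial, RCLike.re_to_real] at h3
  rw [h2, mul_one, mul_one, ← h3] at h1
  exact h1

theorem cfc_sub_of_finite (f g : ℝ → ℝ) (M : Mat d) :
    cfc (fun x => f x - g x) M = cfc f M - cfc g M :=
  cfc_sub f g M (M.finite_real_spectrum.continuousOn _) (M.finite_real_spectrum.continuousOn _)

theorem cfc_const_mul_of_finite (c : ℝ) (f : ℝ → ℝ) (M : Mat d) :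
    cfc (fun x => c * f x) M = c • cfc f M :=
  cfc_const_mul c f M (M.finite_real_spectrum.continuousOn _)

/-- The projection to the positive semidefinite matrices moves a symmetric matrix by no more than
the most negative value of its quadratic form. -/
theorem formBounds_psdProj_sub {δ u : ℝ} (hδ : 0 ≤ δ) {M : Mat d} (hM : M.IsSymm)
    (h : FormBounds (-δ) u M) : FormBounds 0 δ (psdProj M - M) := by
  have hM' := isSymm_iff_isSelfAdjoint.1 hM
  have h1 : psdProj M - M = cfc (fun t : ℝ => max t 0 - t) M := by
    rw [cfc_sub_of_finite, cfc_id' ℝ M hM']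
    rfl
  intro x
  constructor
  · rw [zero_mul, h1]
    exact cfc_form_nonneg (fun t _ => by linarith [le_max_left t 0]) x
  · have h2 : δ • (1 : Mat d) - (psdProj M - M) = cfc (fun t : ℝ => δ - (max t 0 - t)) M := by
      rw [cfc_sub_of_finite, h1, cfc_const δ M hM', Algebra.algebraMap_eq_smul_one]
    have h3 := cfc_form_nonneg (f := fun t : ℝ => δ - (max t 0 - t)) (M := M) (fun t ht => by
      have := (h.le_of_mem_spectrum hM ht).1
      rcases max_cases t 0 with h | h <;> linarith) x
    rw [← h2, sub_mulVec, smul_mulVec, one_mulVec, dotProduct_sub, dotProduct_smul,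
      smul_eq_mul] at h3
    linarith

/-- The spectral projection of a symmetric matrix `Z` to the eigenvalues `≥ τ` splits each vector
into a part where the form is at least `τ` and one where it is at most `τ`; `precond` shrinks the
former by `K^(-1/2)`. -/
theorem precond_decomposition {K κ : ℝ} {Z : Mat d} (hZ : Z.IsSymm) (x : Fin d → ℝ) :
    ∃ v w : Fin d → ℝ, x = v + w ∧ precond K κ Z *ᵥ x = (1 / √K) • v + w ∧ v ⬝ᵥ w = 0 ∧
      v ⬝ᵥ Z *ᵥ w = 0 ∧ κ / 2 * (v ⬝ᵥ v) ≤ v ⬝ᵥ Z *ᵥ v ∧ w ⬝ᵥ Z *ᵥ w ≤ κ / 2 * (w ⬝ᵥ w) := by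
  have hZ' := isSymm_iff_isSelfAdjoint.1 hZ
  set p : ℝ → ℝ := fun t => if κ / 2 ≤ t then 1 else 0 with hp
  set P : Mat d := cfc p Z with hP
  set P' : Mat d := cfc (fun t => 1 - p t) Z with hP'
  have hPs : P.IsSymm := isSymm_cfc _ _
  have hPs' : P'.IsSymm := isSymm_cfc _ _
  have hadd : P' = 1 - P := by
    rw [hP', cfc_sub_of_finite, cfc_const_one ℝ Z hZ']
  have hid : cfc (fun t : ℝ => t) Z = Z := cfc_id' ℝ Z hZ'
  have hprod : ∀ f g : ℝ → ℝ, ∀ y z : Fin d → ℝ,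
      (cfc f Z *ᵥ y) ⬝ᵥ Z *ᵥ (cfc g Z *ᵥ z) = y ⬝ᵥ cfc (fun t => f t * (t * g t)) Z *ᵥ z := by
    intro f g y z
    rw [cfc_mul_of_finite, cfc_mul_of_finite, hid, ← mulVec_mulVec, ← mulVec_mulVec,
      ← dotProduct_mulVec_eq (isSymm_cfc _ _)]
  have hprod1 : ∀ f g : ℝ → ℝ, ∀ y z : Fin d → ℝ,
      (cfc f Z *ᵥ y) ⬝ᵥ (cfc g Z *ᵥ z) = y ⬝ᵥ cfc (fun t => f t * g t) Z *ᵥ z := by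
    intro f g y z
    rw [cfc_mul_of_finite, ← mulVec_mulVec, ← dotProduct_mulVec_eq (isSymm_cfc _ _)]
  have hzero : cfc (fun _ : ℝ => (0 : ℝ)) Z = 0 := cfc_const_zero ℝ Z
  refine ⟨P *ᵥ x, P' *ᵥ x, ?_, ?_, ?_, ?_, ?_, ?_⟩
  · rw [hadd, sub_mulVec, one_mulVec, add_sub_cancel]
  · have : precond K κ Z = (1 / √K) • P + P' := by
      rw [hP, hP', ← cfc_const_mul_of_finite, ← cfc_add (R := ℝ) Z _ _
        (Z.finite_real_spectrum.continuousOn _) (Z.finite_real_spectrum.continuousOn _)]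
      refine cfc_congr fun t _ => ?_
      simp only [hp]
      split_ifs <;> simp
    rw [this, add_mulVec, smul_mulVec]
  · rw [hprod1, show (fun t => p t * (1 - p t)) = fun _ => 0 from ?_, hzero]
    · simp
    · ext t
      simp only [hp]
      split_ifs <;> simp
  · rw [hprod, show (fun t => p t * (t * (1 - p t))) = fun _ => 0 from ?_, hzero]
    · simp
    · ext t
      simp only [hp]
      split_ifs <;> simp
  · have h := cfc_form_nonneg (f := fun t => p t * (t * p t) - κ / 2 * (p t * p t)) (M := Z)
      (fun t _ => by
        simp only [hp]
        split_ifs with h <;> simp [h]) x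
    rw [cfc_sub_of_finite, cfc_const_mul_of_finite, sub_mulVec, smul_mulVec, dotProduct_sub,
      dotProduct_smul, ← hprod, ← hprod1, smul_eq_mul] at h
    linarith
  · have h := cfc_form_nonneg
      (f := fun t => κ / 2 * ((1 - p t) * (1 - p t)) - (1 - p t) * (t * (1 - p t))) (M := Z)
      (fun t _ => by
        simp only [hp]
        split_ifs with h
        · simp
        · push Not at h
          simpa using h.le) x
    rw [cfc_sub_of_finite, cfc_const_mul_of_finite, sub_mulVec, smul_mulVec, dotProduct_sub,
      dotProduct_smul, ← hprod, ← hprod1, smul_eq_mul] at h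
    linarith

/-- One step of preconditioning with an accurate covariance estimate `Z` reduces the condition
number by the factor `0.7`. -/
theorem FormBounds.precond_mul_mul {κ : ℝ} (hκ : 1000 ≤ κ) {A Z : Mat d} (hA : A.IsSymm) (hZ : Z.IsSymm)
    (h : FormBounds 1 κ A) (hE : FormBounds (-(κ / 100)) (κ / 100) (Z - A)) :
    FormBounds 1 (7 / 10 * κ) (((11 / 10 : ℝ) • precond 4 κ Z) * A *
      ((11 / 10 : ℝ) • precond 4 κ Z)) := by
  intro x
  obtain ⟨v, w, hx, hpx, hvw, hZvw, hZv, hZw⟩ := precond_decomposition (K := 4) (κ := κ) hZ x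
  have hsqrt : √(4 : ℝ) = 2 := by
    rw [show (4 : ℝ) = 2 ^ 2 by norm_num, Real.sqrt_sq (by norm_num)]
  rw [hsqrt] at hpx
  -- In terms of V = |v'|² and W = |w|², the new form at x is 1.21 times the form of A at v' + w,
  -- while |x|² = 4V + W.
  set v' : Fin d → ℝ := (1 / 2 : ℝ) • v with hv'
  have hform : x ⬝ᵥ (((11 / 10 : ℝ) • precond 4 κ Z) * A *
      ((11 / 10 : ℝ) • precond 4 κ Z)) *ᵥ x = 121 / 100 * ((v' + w) ⬝ᵥ A *ᵥ (v' + w)) := by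
    simp only [Matrix.smul_mul, Matrix.mul_smul, smul_mulVec, dotProduct_smul, smul_eq_mul]
    rw [← mulVec_mulVec, ← mulVec_mulVec, hpx,
      dotProduct_mulVec_eq (show (precond 4 κ Z).IsSymm from isSymm_cfc _ _), hpx]
    ring
  have hxx : x ⬝ᵥ x = 4 * (v' ⬝ᵥ v') + w ⬝ᵥ w := by
    have : w ⬝ᵥ v = 0 := by rw [dotProduct_comm, hvw]
    rw [hx, hv']
    simp only [add_dotProduct, dotProduct_add, hvw, this, smul_dotProduct, dotProduct_smul,
      smul_eq_mul]
    ring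
  have hv'w : v' ⬝ᵥ w = 0 := by rw [hv', smul_dotProduct, hvw, smul_zero]
  have hwv' : w ⬝ᵥ v' = 0 := by rw [dotProduct_comm, hv'w]
  have hZv'w : v' ⬝ᵥ Z *ᵥ w = 0 := by rw [hv', smul_dotProduct, hZvw, smul_zero]
  have hZv' : κ / 2 * (v' ⬝ᵥ v') ≤ v' ⬝ᵥ Z *ᵥ v' := by
    rw [hv']
    simp only [mulVec_smul, smul_dotProduct, dotProduct_smul, smul_eq_mul]
    linarith
  have hexp : (v' + w) ⬝ᵥ A *ᵥ (v' + w)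
      = v' ⬝ᵥ A *ᵥ v' + 2 * (v' ⬝ᵥ A *ᵥ w) + w ⬝ᵥ A *ᵥ w := by
    simp only [mulVec_add, dotProduct_add, add_dotProduct]
    rw [dotProduct_mulVec_comm' hA w v']
    ring
  have hlow : (v' ⬝ᵥ v') + w ⬝ᵥ w ≤ (v' + w) ⬝ᵥ A *ᵥ (v' + w) := by
    have := (h (v' + w)).1
    simp only [dotProduct_add, add_dotProduct, hv'w, hwv'] at this ⊢
    linarith
  have hcross := hE.two_mul_abs_le (hZ.sub hA) v' w
  -- The two parts are orthogonal for the form of Z, so the cross term of A is pure estimation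
  -- error.
  have hAvw : v' ⬝ᵥ A *ᵥ w = -(v' ⬝ᵥ (Z - A) *ᵥ w) := by
    rw [sub_mulVec, dotProduct_sub, hZv'w]
    ring
  have hEv := hE v'
  have hEw := hE w
  have hAw := (h w).1
  have hAv := (h v').2
  simp only [sub_mulVec, dotProduct_sub] at hEv hEw
  rw [sub_mulVec, dotProduct_sub, hZv'w, zero_sub, abs_neg] at hcross
  obtain ⟨hc1, hc2⟩ := abs_le.1 (le_refl |v' ⬝ᵥ A *ᵥ w|)
  set V := v' ⬝ᵥ v'
  set W := w ⬝ᵥ w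
  have hV0 : 0 ≤ V := dotProduct_self_nonneg' _
  have hW0 : 0 ≤ W := dotProduct_self_nonneg' _
  have hκV : 1000 * V ≤ κ * V := mul_le_mul_of_nonneg_right hκ hV0
  rw [hform, hxx]
  constructor
  -- If w dominates, 1.21(V + W) ≥ 4V + W because 0.21·14 > 2.79. Otherwise v' contributes at least
  -- 0.49κV and the cross terms cost at most 0.15κV, leaving at least 340V + W.
  · by_cases hVW : 14 * V ≤ W
    · linarith
    · rw [hexp]
      have : κ * W ≤ κ * (14 * V) := mul_le_mul_of_nonneg_left (not_le.1 hVW).le (by linarith)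
      linarith
  -- The form is at most 1.01κV + 0.52κW, and 1.21·0.52 < 0.7 is the tight coefficient.
  · rw [hexp]
    have : 0 ≤ κ * W := mul_nonneg (by linarith) hW0
    linarith

end quadraticForm

/-! ### Deterministic analysis of a round and of the output -/

section deterministic

open Matrix

variable {n d : ℕ}

theorem posSemidef_iff_form {M : Mat d} (hM : M.IsSymm) :
    M.PosSemidef ↔ ∀ x : Fin d → ℝ, 0 ≤ x ⬝ᵥ M *ᵥ x := by
  rw [Matrix.posSemidef_iff_dotProduct_mulVec]
  simp only [star_trivial]
  exact and_iff_right (isSymm_iff_isSelfAdjoint.1 hM)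

theorem formBounds_iff_posSemidef {M : Mat d} (hM : M.IsSymm) (l u : ℝ) :
    FormBounds l u M ↔ (M - l • (1 : Mat d)).PosSemidef ∧ (u • (1 : Mat d) - M).PosSemidef := by
  have h1 : ∀ c : ℝ, (c • (1 : Mat d)).IsSymm := fun c => Matrix.isSymm_one.smul c
  rw [posSemidef_iff_form (hM.sub (h1 l)), posSemidef_iff_form ((h1 u).sub hM), ← forall_and]
  simp only [FormBounds, sub_mulVec, smul_mulVec, one_mulVec, dotProduct_sub, dotProduct_smul,
    smul_eq_mul, sub_nonneg]

theorem isPreconditioner_iff {S : Mat d} (hS : S.IsSymm) (A : Mat d) :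
    IsPreconditioner S A ↔ A.IsSymm ∧ FormBounds 1 1000 (A * S * A) := by
  refine and_congr_right fun hA => ?_
  have : (A * S * A).IsSymm := by
    rw [Matrix.IsSymm, transpose_mul, transpose_mul, hA.eq, hS.eq, mul_assoc]
  rw [formBounds_iff_posSemidef this, one_smul]

theorem isClosed_formBounds (l u : ℝ) : IsClosed {M : Mat d | FormBounds l u M} := by
  simp only [FormBounds, Set.ofPred_forall, Set.ofPred_and]
  refine isClosed_iInter fun x => IsClosed.inter ?_ ?_
  · exact isClosed_le continuous_const (by fun_prop)
  · exact isClosed_le (by fun_prop) continuous_const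

theorem isClosed_isPreconditioner {S : Mat d} (hS : S.IsSymm) :
    IsClosed {A : Mat d | IsPreconditioner S A} := by
  simp only [isPreconditioner_iff hS, Set.ofPred_and]
  refine IsClosed.inter (isClosed_eq (by fun_prop) continuous_id) ?_
  exact (isClosed_formBounds 1 1000).preimage
    (f := fun A : Mat d => A * S * A) (by fun_prop)

theorem form_mul_mul_transpose (B S : Mat d) (x : Fin d → ℝ) :
    x ⬝ᵥ (B * S * Bᵀ) *ᵥ x = (Bᵀ *ᵥ x) ⬝ᵥ S *ᵥ (Bᵀ *ᵥ x) := by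
  rw [← mulVec_mulVec, ← mulVec_mulVec, dotProduct_mulVec, ← mulVec_transpose]

theorem isSymm_mul_mul_transpose {S : Mat d} (hS : S.IsSymm) (B : Mat d) :
    (B * S * Bᵀ).IsSymm := by
  rw [Matrix.IsSymm, transpose_mul, transpose_mul, hS.eq, transpose_transpose, mul_assoc]

/-- If `B` preconditions `S`, so does the symmetric factor of its polar decomposition. -/
theorem isPreconditioner_polarFactor {S B : Mat d} (hS : S.IsSymm)
    (h : FormBounds 1 1000 (B * S * Bᵀ)) : IsPreconditioner S (cfc Real.sqrt (Bᵀ * B)) := by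
  set A : Mat d := cfc Real.sqrt (Bᵀ * B) with hA
  have hAs : A.IsSymm := isSymm_cfc _ _
  have hBBs : (Bᵀ * B).IsSymm := by
    rw [Matrix.IsSymm, transpose_mul, transpose_transpose]
  have hpsd : (Bᵀ * B).PosSemidef := by
    rw [posSemidef_iff_form hBBs]
    intro x
    rw [← mulVec_mulVec, dotProduct_mulVec, ← mulVec_transpose, transpose_transpose]
    exact dotProduct_self_nonneg' _
  have hAA : A * A = Bᵀ * B := by
    rw [hA, ← cfc_mul_of_finite]
    conv_rhs => rw [← cfc_id' ℝ (Bᵀ * B) (isSymm_iff_isSelfAdjoint.1 hBBs)]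
    refine cfc_congr fun t ht => Real.mul_self_sqrt ?_
    rw [hpsd.1.spectrum_real_eq_range_eigenvalues] at ht
    obtain ⟨i, rfl⟩ := ht
    exact hpsd.eigenvalues_nonneg i
  -- The lower bound of the form makes Bᵀ injective.
  have hBt : IsUnit Bᵀ := by
    rw [← Matrix.mulVec_injective_iff_isUnit]
    refine (injective_iff_map_eq_zero (Matrix.mulVecLin Bᵀ)).2 fun x hx => ?_
    have hx' : Bᵀ *ᵥ x = 0 := hx
    have h1 := (h x).1
    rw [form_mul_mul_transpose, hx', mulVec_zero, dotProduct_zero, one_mul] at h1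
    exact dotProduct_self_eq_zero.1 (le_antisymm h1 (dotProduct_self_nonneg' x))
  have hBu : IsUnit B.det := by
    rw [← det_transpose]
    exact (Matrix.isUnit_iff_isUnit_det _).1 hBt
  have hBtu : IsUnit Bᵀ.det := by rwa [det_transpose]
  have hAu : IsUnit A.det := by
    have : A.det * A.det = B.det * B.det := by rw [← det_mul, hAA, det_mul, det_transpose]
    exact isUnit_of_mul_isUnit_left (this ▸ hBu.mul hBu)
  rw [isPreconditioner_iff hS]
  refine ⟨hAs, fun x => ?_⟩
  -- Since A² = BᵀB, the matrix Bᵀ⁻¹A is orthogonal. It carries the form of ASA at x to that of BSBᵀ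
  -- at y.
  set y : Fin d → ℝ := Bᵀ⁻¹ *ᵥ (A *ᵥ x) with hy
  have hBy : Bᵀ *ᵥ y = A *ᵥ x := by
    rw [hy, mulVec_mulVec, mul_nonsing_inv _ hBtu, one_mulVec]
  have hyy : y ⬝ᵥ y = x ⬝ᵥ x := by
    have h1 : A * (B⁻¹ * (Bᵀ⁻¹ * A)) = 1 := by
      rw [← mul_assoc B⁻¹, ← Matrix.mul_inv_rev, ← hAA,
        Matrix.mul_inv_rev, mul_assoc, nonsing_inv_mul _ hAu,
        mul_one, mul_nonsing_inv _ hAu]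
    have h2 : y = (Bᵀ⁻¹ * A) *ᵥ x := by rw [hy, mulVec_mulVec]
    have h3 : (Bᵀ⁻¹ * A)ᵀ = A * B⁻¹ := by
      rw [transpose_mul, hAs.eq, transpose_nonsing_inv, transpose_transpose]
    rw [h2, dotProduct_mulVec, ← mulVec_transpose, h3, mulVec_mulVec, mul_assoc, h1, one_mulVec]
  have hf : x ⬝ᵥ (A * S * A) *ᵥ x = y ⬝ᵥ (B * S * Bᵀ) *ᵥ y := by
    rw [form_mul_mul_transpose, hBy]
    have := form_mul_mul_transpose A S x
    rwa [hAs.eq] at this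
  rw [hf, ← hyy]
  exact h y

/-- The samples `W` are in general position for covariance estimation: their empirical covariance
is close to the identity and no sample is long. -/
def GoodSamples (η r : ℝ) (W : Dataset n d) : Prop :=
  (∀ u : Fin d → ℝ, |1 / (n : ℝ) * ∑ i, (u ⬝ᵥ (W i : Fin d → ℝ)) ^ 2 - u ⬝ᵥ u| ≤ η * (u ⬝ᵥ u)) ∧
    ∀ i, ‖W i‖ ^ 2 ≤ r

theorem transform_transform (B R : Mat d) (W : Dataset n d) :
    transform B (transform R W) = transform (B * R) W := by
  funext i
  simp only [transform, mulVec_mulVec]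

theorem form_truncCov {r : ℝ} {X : Dataset n d} (hX : ∀ i, ‖X i‖ ^ 2 ≤ r) (x : Fin d → ℝ) :
    x ⬝ᵥ truncCov r X *ᵥ x = 1 / (n : ℝ) * ∑ i, (x ⬝ᵥ (X i : Fin d → ℝ)) ^ 2 := by
  simp only [truncCov, hX, if_true, smul_mulVec, dotProduct_smul, smul_eq_mul, sum_mulVec,
    dotProduct_sum]
  congr 1
  refine Finset.sum_congr rfl fun i _ => ?_
  rw [vecMulVec_mulVec, dotProduct_smul, dotProduct_comm (X i : Fin d → ℝ) x]
  simp [sq]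

theorem norm_sq_eq_dotProduct (x : EuclideanSpace ℝ (Fin d)) :
    ‖x‖ ^ 2 = (x : Fin d → ℝ) ⬝ᵥ (x : Fin d → ℝ) := by
  rw [EuclideanSpace.real_norm_sq_eq]
  simp [dotProduct, sq]

/-- Passes from Bᵀ to B: for y = BWᵢ, |y|² = ⟨Bᵀy, Wᵢ⟩ ≤ √κ|y|·√r by Cauchy–Schwarz, and a factor
|y| cancels. -/
theorem norm_transform_sq_le {κ r : ℝ} (hκ : 0 ≤ κ) {B : Mat d}
    (h : ∀ x : Fin d → ℝ, (Bᵀ *ᵥ x) ⬝ᵥ (Bᵀ *ᵥ x) ≤ κ * (x ⬝ᵥ x)) {W : Dataset n d}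
    (hW : ∀ i, ‖W i‖ ^ 2 ≤ r) (i : Fin n) : ‖transform B W i‖ ^ 2 ≤ κ * r := by
  set y : Fin d → ℝ := B *ᵥ (W i : Fin d → ℝ) with hy
  have hn : ‖transform B W i‖ ^ 2 = y ⬝ᵥ y := norm_sq_eq_dotProduct _
  have h1 : y ⬝ᵥ y = (Bᵀ *ᵥ y) ⬝ᵥ (W i : Fin d → ℝ) := by
    conv_lhs => rw [hy]
    rw [← hy, dotProduct_mulVec, ← mulVec_transpose]
  have h2 : ((Bᵀ *ᵥ y) ⬝ᵥ (W i : Fin d → ℝ)) ^ 2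
      ≤ ((Bᵀ *ᵥ y) ⬝ᵥ (Bᵀ *ᵥ y)) * ((W i : Fin d → ℝ) ⬝ᵥ (W i : Fin d → ℝ)) := by
    have := Finset.sum_mul_sq_le_sq_mul_sq Finset.univ (Bᵀ *ᵥ y) (W i : Fin d → ℝ)
    simpa only [dotProduct, ← sq] using this
  have h3 := hW i
  rw [norm_sq_eq_dotProduct] at h3
  have h4 := h y
  have hy0 := dotProduct_self_nonneg' y
  have hW0 := dotProduct_self_nonneg' (W i : Fin d → ℝ)
  rw [← h1] at h2
  rw [hn]
  rcases hy0.eq_or_lt with h0 | h0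
  · rw [← h0]
    exact mul_nonneg hκ (hW0.trans h3)
  · have h5 : (y ⬝ᵥ y) ^ 2 ≤ (κ * (y ⬝ᵥ y)) * r :=
      h2.trans (mul_le_mul h4 h3 hW0 (mul_nonneg hκ hy0))
    nlinarith

/-- One round of the recursive preconditioner succeeds on good samples and small noise. -/
theorem FormBounds.ppcStep {κ r : ℝ} (hκ : 1000 ≤ κ) {R S B N : Mat d} (hR : R.IsSymm)
    (hRS : R * R = S) {W : Dataset n d} (hW : GoodSamples (1 / 300) r W)
    (hB : FormBounds 1 κ (B * S * Bᵀ)) (hN : N.IsSymm)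
    (hNb : FormBounds (-(κ / 300)) (κ / 300) N) :
    FormBounds 1 (7 / 10 * κ) (_root_.ppcStep 4 κ (κ * r) (transform R W) B N * S *
      (_root_.ppcStep 4 κ (κ * r) (transform R W) B N)ᵀ) := by
  have hS : S.IsSymm := by rw [Matrix.IsSymm, ← hRS, transpose_mul, hR.eq]
  set A : Mat d := B * S * Bᵀ with hA
  have hAs : A.IsSymm := isSymm_mul_mul_transpose hS B
  have hBR : ∀ x : Fin d → ℝ, ((B * R)ᵀ *ᵥ x) ⬝ᵥ ((B * R)ᵀ *ᵥ x) = x ⬝ᵥ A *ᵥ x := by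
    intro x
    rw [hA, form_mul_mul_transpose, ← hRS, ← mulVec_mulVec, dotProduct_mulVec_eq hR,
      transpose_mul, hR.eq, ← mulVec_mulVec]
  set Cov : Mat d := truncCov (κ * r) (transform B (transform R W)) with hCov
  have hCs : Cov.IsSymm := truncCov_isSymm _ _
  have hlen : ∀ i, ‖transform (B * R) W i‖ ^ 2 ≤ κ * r :=
    norm_transform_sq_le (by linarith) (fun x => by rw [hBR]; exact (hB x).2) hW.2
  -- The sample bound at (BR)ᵀx, whose squared length is the form of A at x, so it holds whatever B
  -- was chosen.
  have hCform : ∀ x : Fin d → ℝ, |x ⬝ᵥ Cov *ᵥ x - x ⬝ᵥ A *ᵥ x| ≤ 1 / 300 * (x ⬝ᵥ A *ᵥ x) := by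
    intro x
    have h1 := hW.1 ((B * R)ᵀ *ᵥ x)
    rw [hBR] at h1
    rw [hCov, transform_transform, form_truncCov hlen]
    convert h1 using 6 with i
    change x ⬝ᵥ ((B * R) *ᵥ (W i : Fin d → ℝ)) = _
    rw [dotProduct_mulVec, ← mulVec_transpose]
  set M : Mat d := Cov + N with hM
  have hMs : M.IsSymm := hCs.add hN
  have hC0 : FormBounds 0 (2 * κ) Cov := by
    intro x
    obtain ⟨h1, h2⟩ := abs_le.1 (hCform x)
    have h3 := dotProduct_self_nonneg' x
    have h4 := hB x
    have h5 : 0 ≤ κ * (x ⬝ᵥ x) := mul_nonneg (by linarith) h3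
    constructor <;> linarith [h4.1, h4.2]
  have hCA : FormBounds (-(κ / 300)) (κ / 300) (Cov - A) := by
    intro x
    obtain ⟨h1, h2⟩ := abs_le.1 (hCform x)
    have h4 := hB x
    rw [sub_mulVec, dotProduct_sub]
    constructor <;> linarith [h4.1, h4.2]
  have hMb : FormBounds (-(κ / 300)) (2 * κ + κ / 300) M := by
    simpa using hC0.add hNb
  have hproj := formBounds_psdProj_sub (by linarith) hMs hMb
  -- Three errors of κ/300: projection, sampling and noise. The projection moves M so little because
  -- the empirical covariance is nonnegative, so only the noise can make M negative.
  have hE : FormBounds (-(κ / 100)) (κ / 100) (psdProj M - A) := by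
    have h1 := (hproj.add (hCA.add hNb)).mono (l' := -(κ / 100)) (u' := κ / 100)
      (by linarith) (by linarith)
    have h2 : psdProj M - M + (Cov - A + N) = psdProj M - A := by
      rw [hM]
      abel
    rwa [h2] at h1
  have hfin := FormBounds.precond_mul_mul (Z := psdProj M) hκ hAs (isSymm_cfc _ _) hB hE
  have hPs : (precond 4 κ (psdProj M)).IsSymm := isSymm_cfc _ _
  have heq : _root_.ppcStep 4 κ (κ * r) (transform R W) B N
      = ((11 / 10 : ℝ) • precond 4 κ (psdProj M)) * B := rfl
  rw [heq, transpose_mul, transpose_smul, hPs.eq]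
  rw [hA] at hfin
  simpa only [mul_assoc] using hfin

end deterministic

/-! ### Nets for quadratic forms -/

section net

variable {d : ℕ}

/-- The unit ball of `ℝᵈ` has a `1/2`-net with at most `5ᵈ` points. -/
theorem exists_half_net (d : ℕ) : ∃ T : Finset (EuclideanSpace ℝ (Fin d)),
    T.card ≤ 5 ^ d ∧ (∀ y ∈ T, ‖y‖ ≤ 1) ∧
      ∀ x : EuclideanSpace ℝ (Fin d), ‖x‖ ≤ 1 → ∃ y ∈ T, ‖x - y‖ ≤ 1 / 2 := by
  classical
  -- A maximal 1/2-separated set is a net. Doubling it gives a 1-separated set in the ball of radius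
  -- 2, which has at most 5^d points.
  let Sep : Finset (EuclideanSpace ℝ (Fin d)) → Prop := fun T =>
    (∀ y ∈ T, ‖y‖ ≤ 1) ∧ ∀ y ∈ T, ∀ z ∈ T, y ≠ z → 1 / 2 ≤ ‖y - z‖
  have hcard : ∀ T, Sep T → T.card ≤ 5 ^ d := by
    intro T hT
    have hinj : Function.Injective fun y : EuclideanSpace ℝ (Fin d) => (2 : ℝ) • y :=
      smul_right_injective _ two_ne_zero
    have := Besicovitch.card_le_of_separated (T.image fun y => (2 : ℝ) • y) (by
      simp only [Finset.mem_image, forall_exists_index, and_imp, forall_apply_eq_imp_iff₂]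
      intro y hy
      rw [norm_smul, Real.norm_ofNat]
      linarith [hT.1 y hy]) (by
      simp only [Finset.mem_image, forall_exists_index, and_imp, forall_apply_eq_imp_iff₂]
      intro y hy z hz hyz
      rw [← smul_sub, norm_smul, Real.norm_ofNat]
      linarith [hT.2 y hy z hz fun h => hyz (by rw [h])])
    rwa [Finset.card_image_of_injective _ hinj, finrank_euclideanSpace_fin] at this
  obtain ⟨k, ⟨T, hT, hk⟩, hmax⟩ : ∃ k, (∃ T, Sep T ∧ T.card = k) ∧
      ∀ T, Sep T → T.card ≤ k := by
    have hex : ∃ k, ∃ T, Sep T ∧ T.card = k := ⟨0, ∅, ⟨by simp, by simp⟩, rfl⟩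
    refine ⟨Nat.findGreatest (fun k => ∃ T, Sep T ∧ T.card = k) (5 ^ d), ?_, fun T hT => ?_⟩
    · exact Nat.findGreatest_spec (P := fun k => ∃ T, Sep T ∧ T.card = k) (Nat.zero_le _)
        ⟨∅, ⟨by simp, by simp⟩, rfl⟩
    · exact Nat.le_findGreatest (hcard T hT) ⟨T, hT, rfl⟩
  refine ⟨T, hcard T hT, hT.1, fun x hx => ?_⟩
  by_contra! hfar
  have hxT : x ∉ T := fun h => by
    have := hfar x h
    rw [sub_self, norm_zero] at this
    linarith
  have hins : Sep (insert x T) := by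
    refine ⟨fun y hy => ?_, fun y hy z hz hyz => ?_⟩
    · rcases Finset.mem_insert.1 hy with rfl | hy
      · exact hx
      · exact hT.1 y hy
    · rcases Finset.mem_insert.1 hy with rfl | hy' <;> rcases Finset.mem_insert.1 hz with rfl | hz'
      · exact absurd rfl hyz
      · exact (hfar z hz').le
      · rw [norm_sub_rev]
        exact (hfar y hy').le
      · exact hT.2 y hy' z hz' hyz
  have := hmax _ hins
  rw [Finset.card_insert_of_notMem hxT, hk] at this
  omega

open Matrix in
/-- The form of a symmetric matrix is controlled by its values on finitely many vectors. -/
theorem exists_form_net (d : ℕ) : ∃ U : Finset (EuclideanSpace ℝ (Fin d)),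
    U.card ≤ 2 * 25 ^ d ∧ (∀ u ∈ U, ‖u‖ ≤ 2) ∧
      ∀ (M : Mat d) (m : ℝ), M.IsSymm →
        (∀ u ∈ U, |(u : Fin d → ℝ) ⬝ᵥ M *ᵥ (u : Fin d → ℝ)| ≤ m) →
          FormBounds (-(2 * m)) (2 * m) M := by
  classical
  obtain ⟨T, hcard, hT1, hT⟩ := exists_half_net d
  -- With sums and differences of net points, polarization turns bounds on the form into bounds on y
  -- · Mz for y, z in the net.
  refine ⟨Finset.image₂ (· + ·) T T ∪ Finset.image₂ (· - ·) T T, ?_, ?_, fun M m hM hm => ?_⟩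
  · have h1 := Finset.card_image₂_le (f := fun x y : EuclideanSpace ℝ (Fin d) => x + y) T T
    have h2 := Finset.card_image₂_le (f := fun x y : EuclideanSpace ℝ (Fin d) => x - y) T T
    have h3 : T.card * T.card ≤ 25 ^ d := by
      calc T.card * T.card ≤ 5 ^ d * 5 ^ d := Nat.mul_le_mul hcard hcard
        _ = 25 ^ d := by rw [← mul_pow]; norm_num
    have h4 := Finset.card_union_le (Finset.image₂ (· + ·) T T) (Finset.image₂ (· - ·) T T)
    omega
  · intro u hu
    rcases Finset.mem_union.1 hu with hu | hu <;> obtain ⟨y, hy, z, hz, rfl⟩ := Finset.mem_image₂.1 hu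
    · exact (norm_add_le _ _).trans (by linarith [hT1 y hy, hT1 z hz])
    · exact (norm_sub_le _ _).trans (by linarith [hT1 y hy, hT1 z hz])
  · set L : EuclideanSpace ℝ (Fin d) →L[ℝ] EuclideanSpace ℝ (Fin d) :=
      toEuclideanCLM (𝕜 := ℝ) M with hL
    have hinner : ∀ x y : EuclideanSpace ℝ (Fin d),
        inner ℝ x (L y) = (x : Fin d → ℝ) ⬝ᵥ M *ᵥ (y : Fin d → ℝ) := fun x y => by
      rw [hL, inner_toEuclideanCLM]
    have hpair : ∀ y ∈ T, ∀ z ∈ T, inner ℝ y (L z) ≤ m / 2 := by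
      intro y hy z hz
      have h1 := hm (y + z) (Finset.mem_union_left _ (Finset.mem_image₂_of_mem hy hz))
      have h2 := hm (y - z) (Finset.mem_union_right _ (Finset.mem_image₂_of_mem hy hz))
      rw [hinner]
      simp only [WithLp.ofLp_add, WithLp.ofLp_sub, mulVec_add, mulVec_sub, dotProduct_add,
        dotProduct_sub, add_dotProduct, sub_dotProduct] at h1 h2
      rw [dotProduct_mulVec_comm' hM z.ofLp y.ofLp] at h1 h2
      linarith [(abs_le.1 h1).2, (abs_le.1 h2).1]
    have hm0 : 0 ≤ m := by
      obtain ⟨y, hy, -⟩ := hT 0 (by simp)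
      exact (abs_nonneg _).trans
        (hm (y + y) (Finset.mem_union_left _ (Finset.mem_image₂_of_mem hy hy)))
    -- Approximating the direction of Lz by a net point gives ‖Lz‖ ≤ m/2 + ‖Lz‖/2. The same
    -- absorption in the other argument then gives ‖L‖ ≤ 2m.
    have hLz : ∀ z ∈ T, ‖L z‖ ≤ m := by
      intro z hz
      rcases (norm_nonneg (L z)).eq_or_lt with h0 | h0
      · rw [← h0]
        exact hm0
      obtain ⟨y, hy, hxy⟩ := hT (‖L z‖⁻¹ • L z) (by
        rw [norm_smul, norm_inv, norm_norm, inv_mul_cancel₀ h0.ne'])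
      have h1 : ‖L z‖ = inner ℝ (‖L z‖⁻¹ • L z - y) (L z) + inner ℝ y (L z) := by
        rw [← inner_add_left, sub_add_cancel, real_inner_smul_left, real_inner_self_eq_norm_sq]
        field_simp
      have h2 : inner ℝ (‖L z‖⁻¹ • L z - y) (L z) ≤ 1 / 2 * ‖L z‖ :=
        (real_inner_le_norm _ _).trans (by gcongr)
      linarith [hpair y hy z hz]
    have hop : ‖L‖ ≤ 2 * m := by
      have : ‖L‖ ≤ m + ‖L‖ / 2 := by
        refine ContinuousLinearMap.opNorm_le_of_unit_norm (by positivity) fun x hx => ?_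
        obtain ⟨z, hz, hxz⟩ := hT x hx.le
        calc ‖L x‖ = ‖L z + L (x - z)‖ := by rw [← map_add, add_sub_cancel]
          _ ≤ ‖L z‖ + ‖L (x - z)‖ := norm_add_le _ _
          _ ≤ m + ‖L‖ * (1 / 2) :=
              add_le_add (hLz z hz) ((L.le_opNorm _).trans (by gcongr))
          _ = m + ‖L‖ / 2 := by ring
      linarith
    intro x
    have h1 := abs_real_inner_le_norm (WithLp.toLp 2 x) (L (WithLp.toLp 2 x))
    have h2 : ‖WithLp.toLp 2 x‖ * ‖L (WithLp.toLp 2 x)‖ ≤ 2 * m * (x ⬝ᵥ x) := by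
      have h3 := norm_sq_eq_dotProduct (WithLp.toLp 2 x)
      have h4 := L.le_of_opNorm_le hop (WithLp.toLp 2 x)
      simp only at h3
      rw [← h3]
      calc _ ≤ ‖WithLp.toLp 2 x‖ * (2 * m * ‖WithLp.toLp 2 x‖) := by gcongr
        _ = _ := by ring
    rw [hinner] at h1
    simp only at h1
    constructor <;> linarith [(abs_le.1 (h1.trans h2)).1, (abs_le.1 (h1.trans h2)).2]

end net

/-! ### Exponential moments -/

section tails

variable {d n : ℕ}

/-- Hypothesis and conclusion are bounds of the same shape, so that it can be iterated over the rows
and columns of the noise. -/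
theorem lintegral_exp_sum_pi_le {n : ℕ} {Ω : Type*} [MeasurableSpace Ω]
    {μ : Fin n → Measure Ω} [∀ i, IsProbabilityMeasure (μ i)] {f : Fin n → Ω → ℝ}
    (hf : ∀ i, Measurable (f i)) {c : Fin n → ℝ}
    (h : ∀ i, ∫⁻ x, ENNReal.ofReal (Real.exp (f i x)) ∂μ i ≤ ENNReal.ofReal (Real.exp (c i))) :
    ∫⁻ x, ENNReal.ofReal (Real.exp (∑ i, f i (x i))) ∂Measure.pi μ
      ≤ ENNReal.ofReal (Real.exp (∑ i, c i)) := by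
  induction n with
  | zero => simp
  | succ n ih =>
    have hμ := (measurePreserving_piFinSuccAbove μ 0).symm
    rw [← hμ.map_eq, lintegral_map (by fun_prop) (MeasurableEquiv.measurable _)]
    have key : ∀ p : Ω × (Fin n → Ω), ENNReal.ofReal (Real.exp (∑ i, f i
        ((MeasurableEquiv.piFinSuccAbove (fun _ => Ω) 0).symm p i)))
        = ENNReal.ofReal (Real.exp (f 0 p.1)) *
          ENNReal.ofReal (Real.exp (∑ i : Fin n, f i.succ (p.2 i))) := by
      intro p
      rw [← ENNReal.ofReal_mul (Real.exp_pos _).le, ← Real.exp_add, Fin.sum_univ_succ]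
      simp [MeasurableEquiv.piFinSuccAbove]
    have hsum : Measurable fun x : Fin n → Ω => ∑ i : Fin n, f i.succ (x i) :=
      Finset.measurable_sum _ fun i _ => (hf _).comp (measurable_pi_apply i)
    simp_rw [key]
    rw [Fin.sum_univ_succ, Real.exp_add, ENNReal.ofReal_mul (Real.exp_pos _).le,
      lintegral_prod_mul (f := fun x => ENNReal.ofReal (Real.exp (f 0 x)))
        (g := fun x : Fin n → Ω => ENNReal.ofReal (Real.exp (∑ i : Fin n, f i.succ (x i))))
        (by fun_prop) (Real.measurable_exp.comp hsum).ennreal_ofReal.aemeasurable]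
    exact mul_le_mul' (h 0) (ih (fun i => hf _) fun i => h _)

theorem measure_lt_le_of_lintegral_exp {Ω : Type*} [MeasurableSpace Ω] {P : Measure Ω} {X : Ω → ℝ}
    (hX : Measurable X) {t c : ℝ} (ht : 0 < t)
    (h : ∫⁻ x, ENNReal.ofReal (Real.exp (t * X x)) ∂P ≤ ENNReal.ofReal (Real.exp c)) (m : ℝ) :
    P {x | m < X x} ≤ ENNReal.ofReal (Real.exp (c - t * m)) := by
  have h1 := mul_meas_ge_le_lintegral (μ := P)
    (f := fun x => ENNReal.ofReal (Real.exp (t * X x))) (by fun_prop)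
    (ENNReal.ofReal (Real.exp (t * m)))
  have h2 : {x | m < X x} ⊆ {x | ENNReal.ofReal (Real.exp (t * m))
      ≤ ENNReal.ofReal (Real.exp (t * X x))} := by
    intro x hx
    have : m < X x := hx
    exact ENNReal.ofReal_le_ofReal (Real.exp_le_exp.2 (by gcongr))
  have h3 := (mul_le_mul_right (measure_mono (μ := P) h2)
    (ENNReal.ofReal (Real.exp (t * m)))).trans (h1.trans h)
  have h4 : ENNReal.ofReal (Real.exp c)
      = ENNReal.ofReal (Real.exp (t * m)) * ENNReal.ofReal (Real.exp (c - t * m)) := by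
    rw [← ENNReal.ofReal_mul (Real.exp_pos _).le, ← Real.exp_add]
    congr 2
    ring
  rw [h4] at h3
  exact (ENNReal.mul_le_mul_iff_right (by simp [Real.exp_pos]) ENNReal.ofReal_ne_top).1 h3

theorem lintegral_exp_mul_gaussianReal (v : NNReal) (t : ℝ) :
    ∫⁻ x, ENNReal.ofReal (Real.exp (t * x)) ∂gaussianReal 0 v
      = ENNReal.ofReal (Real.exp (v * t ^ 2 / 2)) := by
  rw [← ofReal_integral_eq_lintegral_ofReal (integrable_exp_mul_gaussianReal t)
    (Filter.Eventually.of_forall fun _ => (Real.exp_pos _).le)]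
  have := congrFun (mgf_fun_id_gaussianReal (μ := 0) (v := v)) t
  simp only [mgf, zero_mul, zero_add] at this
  rw [this]

theorem neg_log_one_sub_le {x : ℝ} (hx : |x| ≤ 1 / 2) : -Real.log (1 - x) ≤ x + 2 * x ^ 2 := by
  have h := Real.abs_log_sub_add_sum_range_le (show |x| < 1 by linarith) 1
  simp only [Finset.sum_range_one, zero_add, pow_one, Nat.cast_zero, div_one] at h
  have h2 : |x| ^ (1 + 1) / (1 - |x|) ≤ 2 * x ^ 2 := by
    rw [div_le_iff₀ (by linarith), ← sq_abs x, one_add_one_eq_two]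
    nlinarith [mul_nonneg (sq_nonneg |x|) (show 0 ≤ 1 / 2 - |x| by linarith)]
  linarith [(abs_le.1 (h.trans h2)).1]

/-- The square of a Gaussian variable is subexponential. -/
theorem lintegral_exp_sq_gaussianReal_le (v : NNReal) {t : ℝ} (ht : |t * v| ≤ 1 / 4) :
    ∫⁻ x, ENNReal.ofReal (Real.exp (t * x ^ 2)) ∂gaussianReal 0 v
      ≤ ENNReal.ofReal (Real.exp (t * v + 4 * (t * v) ^ 2)) := by
  by_cases hv : v = 0
  · subst hv
    simp
  have hv0 : (0 : ℝ) < v := by positivity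
  -- Tilting N(0, v) by exp(tx²) gives y^(-1/2) times the density of N(0, v/y).
  set y : ℝ := 1 - 2 * (t * v) with hy
  have hy0 : 0 < y := by linarith [(abs_le.1 ht).2]
  set w : NNReal := v / y.toNNReal with hw
  have hw0 : w ≠ 0 := by simp [hw, hv, hy0]
  have hwc : (w : ℝ) = v / y := by rw [hw, NNReal.coe_div, Real.coe_toNNReal _ hy0.le]
  rw [gaussianReal_of_var_ne_zero _ hv,
    lintegral_withDensity_eq_lintegral_mul _ (measurable_gaussianPDF 0 v) (by fun_prop)]
  have hden : ∀ x, (gaussianPDF 0 v * fun x => ENNReal.ofReal (Real.exp (t * x ^ 2))) x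
      = ENNReal.ofReal (√y)⁻¹ * gaussianPDF 0 w x := by
    intro x
    simp only [Pi.mul_apply, gaussianPDF]
    rw [← ENNReal.ofReal_mul (gaussianPDFReal_nonneg _ _ _), ← ENNReal.ofReal_mul (by positivity),
      gaussianPDFReal, gaussianPDFReal, hwc, mul_assoc (_⁻¹), ← Real.exp_add, ← mul_assoc,
      ← mul_inv, ← Real.sqrt_mul hy0.le,
      show y * (2 * Real.pi * (v / y)) = 2 * Real.pi * v by field_simp]
    congr 3
    field_simp
    rw [hy]
    ring
  simp_rw [hden]
  rw [lintegral_const_mul _ (measurable_gaussianPDF _ _), lintegral_gaussianPDF_eq_one _ hw0,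
    mul_one]
  refine ENNReal.ofReal_le_ofReal ?_
  have h1 : (√y)⁻¹ = Real.exp (-Real.log y / 2) := by
    rw [Real.sqrt_eq_rpow, ← Real.rpow_neg hy0.le, Real.rpow_def_of_pos hy0]
    congr 1
    ring
  rw [h1, Real.exp_le_exp]
  have h2 := neg_log_one_sub_le (x := 2 * (t * v)) (by rw [abs_mul, abs_two]; linarith)
  rw [← hy] at h2
  linarith

open Matrix in
theorem lintegral_dotProduct_stdGaussian (u : EuclideanSpace ℝ (Fin d)) {f : ℝ → ENNReal}
    (hf : Measurable f) :
    ∫⁻ x, f ((u : Fin d → ℝ) ⬝ᵥ (x : Fin d → ℝ)) ∂stdGaussian (EuclideanSpace ℝ (Fin d))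
      = ∫⁻ x, f x ∂gaussianReal 0 (‖u‖ ^ 2).toNNReal := by
  have h1 : (stdGaussian (EuclideanSpace ℝ (Fin d))).map (innerSL ℝ u)
      = gaussianReal 0 (‖u‖ ^ 2).toNNReal := by
    rw [IsGaussian.map_eq_gaussianReal, integral_strongDual_stdGaussian, variance_dual_stdGaussian,
      innerSL_apply_norm]
  rw [← h1, lintegral_map hf (by fun_prop)]
  refine lintegral_congr fun x => ?_
  rw [innerSL_apply_apply, EuclideanSpace.inner_eq_star_dotProduct, star_trivial, dotProduct_comm]

end tails

/-! ### Deviation bounds for the noise and for the samples -/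

section deviation

open Matrix

variable {d n : ℕ}

/-- Only entries on and above the diagonal are independent, so symmetric sums are folded onto them
before taking exponential moments. -/
theorem sum_sum_eq_upper {F : Fin d → Fin d → ℝ} (hF : ∀ i j, F i j = F j i) :
    ∑ i, ∑ j, F i j
      = ∑ i, ∑ j, if i < j then 2 * F i j else if i = j then F i j else 0 := by
  have h1 : ∑ i, ∑ j, (if j < i then F i j else 0) = ∑ i, ∑ j, if i < j then F i j else 0 := by
    rw [Finset.sum_comm]
    exact Finset.sum_congr rfl fun i _ => Finset.sum_congr rfl fun j _ => by rw [hF]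
  have h2 : ∑ i, ∑ j, F i j = ∑ i, ∑ j, (((if i < j then F i j else 0) +
      if i = j then F i j else 0) + if j < i then F i j else 0) := by
    refine Finset.sum_congr rfl fun i _ => Finset.sum_congr rfl fun j _ => ?_
    rcases lt_trichotomy i j with h | h | h
    · simp [h, h.ne, h.not_gt]
    · simp [h]
    · simp [h, h.ne', h.not_gt]
  rw [h2]
  simp only [Finset.sum_add_distrib]
  rw [h1]
  simp only [← Finset.sum_add_distrib]
  refine Finset.sum_congr rfl fun i _ => Finset.sum_congr rfl fun j _ => ?_
  by_cases h : i < j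
  · simp [h, h.ne, two_mul]
  · simp [h]

/-- The symmetric matrix with given upper triangle. -/
def symmOfUpper (g : Fin d → Fin d → ℝ) : Mat d := Matrix.of fun i j => g (min i j) (max i j)

theorem isSymm_symmOfUpper (g : Fin d → Fin d → ℝ) : (symmOfUpper g).IsSymm :=
  Matrix.IsSymm.ext fun i j => by simp [symmOfUpper, min_comm, max_comm]

theorem form_symmOfUpper (u : Fin d → ℝ) (g : Fin d → Fin d → ℝ) :
    u ⬝ᵥ symmOfUpper g *ᵥ u = ∑ i, ∑ j,
      (if i < j then 2 * (u i * u j) else if i = j then u i * u j else 0) * g i j := by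
  have h : u ⬝ᵥ symmOfUpper g *ᵥ u = ∑ i, ∑ j, u i * u j * g (min i j) (max i j) := by
    simp only [dotProduct, mulVec, symmOfUpper, Matrix.of_apply, Finset.mul_sum]
    exact Finset.sum_congr rfl fun i _ => Finset.sum_congr rfl fun j _ => by ring
  rw [h, sum_sum_eq_upper fun i j => by rw [min_comm, max_comm, mul_comm (u i)]]
  refine Finset.sum_congr rfl fun i _ => Finset.sum_congr rfl fun j _ => ?_
  split_ifs with h1 h2
  · rw [min_eq_left h1.le, max_eq_right h1.le]
    ring
  · simp [h2]
  · simp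

theorem sum_upper_coeff_sq_le (u : Fin d → ℝ) :
    ∑ i, ∑ j, (if i < j then 2 * (u i * u j) else if i = j then u i * u j else 0) ^ 2
      ≤ 2 * (u ⬝ᵥ u) ^ 2 := by
  have h : 2 * (u ⬝ᵥ u) ^ 2 = ∑ i, ∑ j, 2 * (u i ^ 2 * u j ^ 2) := by
    simp only [dotProduct, ← sq, ← Finset.mul_sum]
    rw [sq (∑ i, _), Finset.sum_mul]
  rw [h, sum_sum_eq_upper (F := fun i j => 2 * (u i ^ 2 * u j ^ 2)) fun i j => by ring]
  refine Finset.sum_le_sum fun i _ => Finset.sum_le_sum fun j _ => ?_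
  split_ifs with h1 h2
  · exact le_of_eq (by ring)
  · nlinarith [mul_nonneg (sq_nonneg (u i)) (sq_nonneg (u j))]
  · simp

theorem lintegral_exp_form_symmOfUpper_le (v : NNReal) (u : Fin d → ℝ) (t : ℝ) :
    ∫⁻ g, ENNReal.ofReal (Real.exp (t * (u ⬝ᵥ symmOfUpper g *ᵥ u)))
        ∂(Measure.pi fun _ : Fin d => Measure.pi fun _ : Fin d => gaussianReal 0 v)
      ≤ ENNReal.ofReal (Real.exp (v * t ^ 2 * (u ⬝ᵥ u) ^ 2)) := by
  set c : Fin d → Fin d → ℝ :=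
    fun i j => if i < j then 2 * (u i * u j) else if i = j then u i * u j else 0 with hc
  have h1 : ∀ g : Fin d → Fin d → ℝ, t * (u ⬝ᵥ symmOfUpper g *ᵥ u)
      = ∑ i, ∑ j, t * c i j * g i j := by
    intro g
    rw [form_symmOfUpper]
    simp only [Finset.mul_sum, mul_assoc, hc]
  simp_rw [h1]
  have h2 := fun i => lintegral_exp_sum_pi_le (μ := fun _ : Fin d => gaussianReal 0 v)
    (f := fun j x => t * c i j * x) (fun j => by fun_prop)
    (c := fun j => v * (t * c i j) ^ 2 / 2)
    fun j => (lintegral_exp_mul_gaussianReal v (t * c i j)).le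
  have h3 := lintegral_exp_sum_pi_le
    (μ := fun _ : Fin d => Measure.pi fun _ : Fin d => gaussianReal 0 v)
    (f := fun i (x : Fin d → ℝ) => ∑ j, t * c i j * x j) (fun i => by fun_prop) h2
  refine h3.trans (ENNReal.ofReal_le_ofReal (Real.exp_le_exp.2 ?_))
  have h4 : ∑ i, ∑ j, v * (t * c i j) ^ 2 / 2 = v * t ^ 2 / 2 * ∑ i, ∑ j, c i j ^ 2 := by
    simp only [Finset.mul_sum]
    exact Finset.sum_congr rfl fun i _ => Finset.sum_congr rfl fun j _ => by ring
  rw [h4]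
  calc v * t ^ 2 / 2 * ∑ i, ∑ j, c i j ^ 2 ≤ v * t ^ 2 / 2 * (2 * (u ⬝ᵥ u) ^ 2) := by
        gcongr
        exact sum_upper_coeff_sq_le u
    _ = _ := by ring

theorem measure_lt_abs_le {Ω : Type*} [MeasurableSpace Ω] {P : Measure Ω} {X : Ω → ℝ}
    (hX : Measurable X) {t c : ℝ} (ht : 0 < t)
    (h : ∀ r, |r| = t → ∫⁻ x, ENNReal.ofReal (Real.exp (r * X x)) ∂P ≤ ENNReal.ofReal (Real.exp c))
    (m : ℝ) : P {x | m < |X x|} ≤ 2 * ENNReal.ofReal (Real.exp (c - t * m)) := by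
  have h1 := measure_lt_le_of_lintegral_exp hX ht (h t (abs_of_pos ht)) m
  have h2 := measure_lt_le_of_lintegral_exp (X := fun x => -X x) hX.neg ht
    (by simpa using h (-t) (by rw [abs_neg, abs_of_pos ht])) m
  have h3 : {x | m < |X x|} ⊆ {x | m < X x} ∪ {x | m < -X x} := fun x hx => by
    have hx' : m < |X x| := hx
    exact (lt_abs.1 hx').imp id id
  calc P {x | m < |X x|} ≤ P {x | m < X x} + P {x | m < -X x} :=
        (measure_mono h3).trans (measure_union_le _ _)
    _ ≤ _ := by
        rw [two_mul]
        exact add_le_add h1 h2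

theorem measurable_form (u : Fin d → ℝ) : Measurable fun M : Mat d => u ⬝ᵥ M *ᵥ u :=
  (show Continuous fun M : Mat d => u ⬝ᵥ M *ᵥ u by fun_prop).measurable

/-- Operator norm bound for the symmetric Gaussian noise matrix. -/
theorem gue_not_formBounds_le {s m : ℝ} (hs : s ≠ 0) (hm : 0 < m) :
    gue d s {N | ¬(N.IsSymm ∧ FormBounds (-(2 * m)) (2 * m) N)}
      ≤ ENNReal.ofReal (4 * 25 ^ d * Real.exp (-(m ^ 2 / (64 * s ^ 2)))) := by
  obtain ⟨U, hcard, hU2, hU⟩ := exists_form_net d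
  have hs2 : 0 < s ^ 2 := by positivity
  set γ : Measure (Fin d → Fin d → ℝ) :=
    Measure.pi fun _ : Fin d => Measure.pi fun _ : Fin d => gaussianReal 0 (s ^ 2).toNNReal with hγ
  have hmeas : MeasurableSet {N : Mat d | ¬(N.IsSymm ∧ FormBounds (-(2 * m)) (2 * m) N)} := by
    refine MeasurableSet.compl (IsClosed.measurableSet ?_)
    exact (isClosed_eq (by fun_prop) continuous_id).inter (isClosed_formBounds _ _)
  have hgue : gue d s = γ.map symmOfUpper := rfl
  have hsm : Measurable (symmOfUpper (d := d)) := measurable_symmOfUpper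
  rw [hgue, Measure.map_apply hsm hmeas]
  have hsub : symmOfUpper ⁻¹' {N : Mat d | ¬(N.IsSymm ∧ FormBounds (-(2 * m)) (2 * m) N)}
      ⊆ ⋃ u ∈ U, {g | m < |(u : Fin d → ℝ) ⬝ᵥ symmOfUpper g *ᵥ (u : Fin d → ℝ)|} := by
    intro g hg
    by_contra hcon
    simp only [Set.mem_iUnion, Set.mem_ofPred_eq, not_exists, not_lt] at hcon
    exact hg ⟨isSymm_symmOfUpper g, hU _ m (isSymm_symmOfUpper g) hcon⟩
  have htail : ∀ u ∈ U, γ {g | m < |(u : Fin d → ℝ) ⬝ᵥ symmOfUpper g *ᵥ (u : Fin d → ℝ)|}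
      ≤ 2 * ENNReal.ofReal (Real.exp (-(m ^ 2 / (64 * s ^ 2)))) := by
    intro u hu
    -- On the net |u|⁴ ≤ 16, and this t minimises the Chernoff exponent 16s²t² - tm.
    have h := measure_lt_abs_le (P := γ) (t := m / (32 * s ^ 2))
      (c := s ^ 2 * (m / (32 * s ^ 2)) ^ 2 * 16)
      ((measurable_form (u : Fin d → ℝ)).comp hsm) (by positivity) (fun r hr => by
        refine (lintegral_exp_form_symmOfUpper_le _ _ _).trans ?_
        rw [Real.coe_toNNReal _ hs2.le, ← hr, sq_abs]
        have h1 : ((u : Fin d → ℝ) ⬝ᵥ (u : Fin d → ℝ)) ^ 2 ≤ 16 := by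
          rw [← norm_sq_eq_dotProduct]
          have := hU2 u hu
          calc (‖u‖ ^ 2) ^ 2 ≤ (2 ^ 2) ^ 2 := by gcongr
            _ = 16 := by norm_num
        gcongr) m
    refine h.trans (le_of_eq ?_)
    congr 4
    field_simp
    ring
  calc γ _ ≤ γ (⋃ u ∈ U, {g | m < |(u : Fin d → ℝ) ⬝ᵥ symmOfUpper g *ᵥ (u : Fin d → ℝ)|}) :=
        measure_mono hsub
    _ ≤ ∑ u ∈ U, γ {g | m < |(u : Fin d → ℝ) ⬝ᵥ symmOfUpper g *ᵥ (u : Fin d → ℝ)|} :=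
        measure_biUnion_finset_le _ _
    _ ≤ ∑ _u ∈ U, 2 * ENNReal.ofReal (Real.exp (-(m ^ 2 / (64 * s ^ 2)))) :=
        Finset.sum_le_sum htail
    _ = (U.card : ENNReal) * (2 * ENNReal.ofReal (Real.exp (-(m ^ 2 / (64 * s ^ 2))))) := by
        rw [Finset.sum_const, nsmul_eq_mul]
    _ ≤ ((2 * 25 ^ d : ℕ) : ENNReal) *
          (2 * ENNReal.ofReal (Real.exp (-(m ^ 2 / (64 * s ^ 2))))) := by gcongr
    _ = _ := by
        rw [← ENNReal.ofReal_natCast, show (2 : ENNReal) = ENNReal.ofReal 2 by simp,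
          ← ENNReal.ofReal_mul (by norm_num), ← ENNReal.ofReal_mul (by positivity)]
        congr 1
        push_cast
        ring

theorem lintegral_exp_sq_sub_stdGaussian_le (u : EuclideanSpace ℝ (Fin d)) {t : ℝ}
    (ht : |t * ‖u‖ ^ 2| ≤ 1 / 4) :
    ∫⁻ x, ENNReal.ofReal (Real.exp (t * (((u : Fin d → ℝ) ⬝ᵥ (x : Fin d → ℝ)) ^ 2 - ‖u‖ ^ 2)))
        ∂stdGaussian (EuclideanSpace ℝ (Fin d))
      ≤ ENNReal.ofReal (Real.exp (4 * (t * ‖u‖ ^ 2) ^ 2)) := by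
  rw [lintegral_dotProduct_stdGaussian u
    (f := fun y => ENNReal.ofReal (Real.exp (t * (y ^ 2 - ‖u‖ ^ 2)))) (by fun_prop)]
  have h1 : ∀ y : ℝ, ENNReal.ofReal (Real.exp (t * (y ^ 2 - ‖u‖ ^ 2)))
      = ENNReal.ofReal (Real.exp (-(t * ‖u‖ ^ 2))) * ENNReal.ofReal (Real.exp (t * y ^ 2)) := by
    intro y
    rw [← ENNReal.ofReal_mul (Real.exp_pos _).le, ← Real.exp_add]
    congr 2
    ring
  simp_rw [h1]
  rw [lintegral_const_mul _ (by fun_prop)]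
  have hv : (((‖u‖ ^ 2).toNNReal : NNReal) : ℝ) = ‖u‖ ^ 2 := Real.coe_toNNReal _ (sq_nonneg _)
  refine (mul_le_mul_right (lintegral_exp_sq_gaussianReal_le _ (by rwa [hv])) _).trans
    (le_of_eq ?_)
  rw [hv, ← ENNReal.ofReal_mul (Real.exp_pos _).le, ← Real.exp_add]
  congr 2
  ring

theorem measurable_dotProduct_eval (u : Fin d → ℝ) :
    Measurable fun x : EuclideanSpace ℝ (Fin d) => u ⬝ᵥ (x : Fin d → ℝ) := by
  simp only [dotProduct]
  fun_prop

/-- Bernstein's inequality for the empirical second moment of a Gaussian sample in one direction. -/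
theorem stdGaussian_lt_abs_sum_sq_le {u : EuclideanSpace ℝ (Fin d)} (hu : ‖u‖ ≤ 2) {m : ℝ}
    (hm : 0 < m) (hm8 : m ≤ 8) :
    (Measure.pi fun _ : Fin n => stdGaussian (EuclideanSpace ℝ (Fin d)))
        {W | n * m < |∑ i, (((u : Fin d → ℝ) ⬝ᵥ (W i : Fin d → ℝ)) ^ 2 - ‖u‖ ^ 2)|}
      ≤ 2 * ENNReal.ofReal (Real.exp (-(n * m ^ 2 / 256))) := by
  have hu4 : ‖u‖ ^ 2 ≤ 4 := by nlinarith [norm_nonneg u]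
  have hmeas : Measurable fun W : Dataset n d =>
      ∑ i, (((u : Fin d → ℝ) ⬝ᵥ (W i : Fin d → ℝ)) ^ 2 - ‖u‖ ^ 2) :=
    Finset.measurable_sum _ fun i _ => (((measurable_dotProduct_eval (u : Fin d → ℝ)).comp
      (measurable_pi_apply i)).pow_const 2).sub_const _
  -- This t minimises 64t² - tm, and m ≤ 8 keeps t‖u‖² ≤ 4t within the allowed range 1/4.
  have h := measure_lt_abs_le (P := Measure.pi fun _ : Fin n =>
      stdGaussian (EuclideanSpace ℝ (Fin d))) (t := m / 128) (c := n * (64 * (m / 128) ^ 2))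
    hmeas (by positivity) (fun r hr => by
      have hr2 : r ^ 2 = (m / 128) ^ 2 := by rw [← hr, sq_abs]
      simp only [Finset.mul_sum]
      have hb : |r * ‖u‖ ^ 2| ≤ 1 / 4 := by
        rw [abs_mul, hr, abs_of_nonneg (sq_nonneg ‖u‖)]
        nlinarith [sq_nonneg ‖u‖]
      refine (lintegral_exp_sum_pi_le (f := fun (_ : Fin n) (x : EuclideanSpace ℝ (Fin d)) =>
        r * (((u : Fin d → ℝ) ⬝ᵥ (x : Fin d → ℝ)) ^ 2 - ‖u‖ ^ 2))
        (fun i => (((measurable_dotProduct_eval (u : Fin d → ℝ)).pow_const 2).sub_const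
          _).const_mul _) fun i => lintegral_exp_sq_sub_stdGaussian_le u hb).trans ?_
      refine ENNReal.ofReal_le_ofReal (Real.exp_le_exp.2 ?_)
      rw [Finset.sum_const, Finset.card_univ, Fintype.card_fin, nsmul_eq_mul, mul_pow, hr2]
      have : (‖u‖ ^ 2) ^ 2 ≤ 4 ^ 2 := by gcongr
      refine mul_le_mul_of_nonneg_left ?_ n.cast_nonneg
      nlinarith [sq_nonneg (m / 128)]) (n * m)
  refine h.trans (le_of_eq ?_)
  congr 4
  ring

/-- Chernoff at t = 1/4, where each coordinate contributes at most exp(1/4 + 4/16). -/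
theorem stdGaussian_lt_norm_sq_le (r : ℝ) :
    stdGaussian (EuclideanSpace ℝ (Fin d)) {x | r < ‖x‖ ^ 2}
      ≤ ENNReal.ofReal (Real.exp (d / 2 - r / 4)) := by
  have h := measure_lt_le_of_lintegral_exp (P := stdGaussian (EuclideanSpace ℝ (Fin d)))
    (X := fun x => ‖x‖ ^ 2) (by fun_prop) (t := 1 / 4) (c := d / 2) (by norm_num) (by
      rw [← map_pi_eq_stdGaussian, lintegral_map (by fun_prop) (by fun_prop)]
      simp only [EuclideanSpace.real_norm_sq_eq, Finset.mul_sum]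
      refine (lintegral_exp_sum_pi_le (μ := fun _ : Fin d => gaussianReal 0 1)
        (f := fun _ x => 1 / 4 * x ^ 2) (fun i => by fun_prop) (c := fun _ => 1 / 2)
        fun i => ?_).trans ?_
      · refine (lintegral_exp_sq_gaussianReal_le 1 (t := 1 / 4) (by norm_num)).trans ?_
        refine ENNReal.ofReal_le_ofReal (Real.exp_le_exp.2 ?_)
        norm_num
      · rw [Finset.sum_const, Finset.card_univ, Fintype.card_fin, nsmul_eq_mul]
        refine le_of_eq ?_
        congr 2
        ring) r
  refine h.trans (le_of_eq ?_)
  congr 2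
  ring

/-- Gaussian samples are good with high probability. -/
theorem stdGaussian_not_goodSamples_le (hn : 0 < n) {m : ℝ} (hm : 0 < m) (hm8 : m ≤ 8) (r : ℝ) :
    (Measure.pi fun _ : Fin n => stdGaussian (EuclideanSpace ℝ (Fin d)))
        {W | ¬GoodSamples (2 * m) r W}
      ≤ ENNReal.ofReal (4 * 25 ^ d * Real.exp (-(n * m ^ 2 / 256))) +
        ENNReal.ofReal (n * Real.exp (d / 2 - r / 4)) := by
  obtain ⟨U, hcard, hU2, hU⟩ := exists_form_net d
  set P := Measure.pi fun _ : Fin n => stdGaussian (EuclideanSpace ℝ (Fin d)) with hP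
  have hn' : (0 : ℝ) < n := by exact_mod_cast hn
  set E : EuclideanSpace ℝ (Fin d) → Set (Dataset n d) := fun u =>
    {W | n * m < |∑ i, (((u : Fin d → ℝ) ⬝ᵥ (W i : Fin d → ℝ)) ^ 2 - ‖u‖ ^ 2)|} with hE
  have hsub : {W : Dataset n d | ¬GoodSamples (2 * m) r W}
      ⊆ (⋃ u ∈ U, E u) ∪ ⋃ i : Fin n, {W | r < ‖W i‖ ^ 2} := by
    intro W hW
    by_contra hcon
    simp only [Set.mem_union, Set.mem_iUnion, Set.mem_ofPred_eq, not_or, not_exists, not_lt, hE]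
      at hcon
    obtain ⟨h1, h2⟩ := hcon
    refine hW ⟨?_, h2⟩
    have hsymm : (truncCov r W - 1).IsSymm := (truncCov_isSymm r W).sub Matrix.isSymm_one
    have hform : ∀ u : Fin d → ℝ, u ⬝ᵥ (truncCov r W - 1) *ᵥ u
        = 1 / (n : ℝ) * ∑ i, (u ⬝ᵥ (W i : Fin d → ℝ)) ^ 2 - u ⬝ᵥ u := by
      intro u
      rw [sub_mulVec, dotProduct_sub, one_mulVec, form_truncCov h2]
    have hb := hU (truncCov r W - 1) m hsymm fun u hu => by
      rw [hform]
      have h3 := h1 u hu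
      rw [Finset.sum_sub_distrib, Finset.sum_const, Finset.card_univ, Fintype.card_fin,
        nsmul_eq_mul, norm_sq_eq_dotProduct] at h3
      have h4 : 1 / (n : ℝ) * ∑ i, ((u : Fin d → ℝ) ⬝ᵥ (W i : Fin d → ℝ)) ^ 2
          - (u : Fin d → ℝ) ⬝ᵥ (u : Fin d → ℝ)
          = (∑ i, ((u : Fin d → ℝ) ⬝ᵥ (W i : Fin d → ℝ)) ^ 2
            - n * ((u : Fin d → ℝ) ⬝ᵥ (u : Fin d → ℝ))) / n := by
        field_simp
      rw [h4, abs_div, abs_of_pos hn', div_le_iff₀ hn', mul_comm m]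
      exact h3
    intro u
    have := hb u
    rw [hform, neg_mul] at this
    exact abs_le.2 this
  have hEu : ∀ u ∈ U, P (E u) ≤ 2 * ENNReal.ofReal (Real.exp (-(n * m ^ 2 / 256))) :=
    fun u hu => stdGaussian_lt_abs_sum_sq_le (hU2 u hu) hm hm8
  have hnorm : ∀ i : Fin n, P {W | r < ‖W i‖ ^ 2} ≤ ENNReal.ofReal (Real.exp (d / 2 - r / 4)) := by
    intro i
    have hms : MeasurableSet {x : EuclideanSpace ℝ (Fin d) | r < ‖x‖ ^ 2} :=
      measurableSet_lt (by fun_prop) (by fun_prop)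
    have := (measurePreserving_eval (fun _ : Fin n =>
      stdGaussian (EuclideanSpace ℝ (Fin d))) i).measure_preimage hms.nullMeasurableSet
    exact (le_of_eq this).trans (stdGaussian_lt_norm_sq_le r)
  calc P _ ≤ P (⋃ u ∈ U, E u) + P (⋃ i : Fin n, {W | r < ‖W i‖ ^ 2}) :=
        (measure_mono hsub).trans (measure_union_le _ _)
    _ ≤ ∑ u ∈ U, P (E u) + ∑ i : Fin n, P {W | r < ‖W i‖ ^ 2} :=
        add_le_add (measure_biUnion_finset_le _ _) (measure_iUnion_fintype_le _ _)
    _ ≤ ∑ _u ∈ U, 2 * ENNReal.ofReal (Real.exp (-(n * m ^ 2 / 256))) +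
          ∑ _i : Fin n, ENNReal.ofReal (Real.exp (d / 2 - r / 4)) :=
        add_le_add (Finset.sum_le_sum hEu) (Finset.sum_le_sum fun i _ => hnorm i)
    _ ≤ ((2 * 25 ^ d : ℕ) : ENNReal) * (2 * ENNReal.ofReal (Real.exp (-(n * m ^ 2 / 256)))) +
          (n : ENNReal) * ENNReal.ofReal (Real.exp (d / 2 - r / 4)) := by
        rw [Finset.sum_const, nsmul_eq_mul, Finset.sum_const, nsmul_eq_mul, Finset.card_univ,
          Fintype.card_fin]
        gcongr
    _ = _ := by
        rw [← ENNReal.ofReal_natCast, show (2 : ENNReal) = ENNReal.ofReal 2 by simp,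
          ← ENNReal.ofReal_mul (by norm_num), ← ENNReal.ofReal_mul (by positivity),
          ← ENNReal.ofReal_natCast, ← ENNReal.ofReal_mul (by positivity)]
        congr 2
        push_cast
        ring

end deviation

/-! ### The number of rounds -/

section rounds

theorem one_lt_log_ten : (1 : ℝ) < Real.log 10 := by
  rw [Real.lt_log_iff_exp_lt (by norm_num)]
  linarith [Real.exp_one_lt_d9]

theorem log_ten_sevenths_ge : (3 / 10 : ℝ) ≤ Real.log (10 / 7) := by
  have := Real.one_sub_inv_le_log_of_pos (show (0 : ℝ) < 10 / 7 by norm_num)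
  norm_num at this ⊢
  linarith

/-- Subtracting log 1000 > 3 absorbs the +1 of the ceiling, so no additive constant is left, even
for κ near 1. -/
theorem ppcRounds_le {κ : ℝ} (hκ : 1 ≤ κ) : (ppcRounds κ : ℝ) ≤ 4 * Real.log κ := by
  have hl := log_ten_sevenths_ge
  have hκ0 : 0 ≤ Real.log κ := Real.log_nonneg hκ
  rcases le_or_gt (Real.log (κ / 1000) / Real.log (10 / 7)) 0 with h | h
  · rw [ppcRounds, Nat.ceil_eq_zero.2 h]
    simpa using hκ0
  · have h1 : (ppcRounds κ : ℝ) < Real.log (κ / 1000) / Real.log (10 / 7) + 1 :=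
      Nat.ceil_lt_add_one h.le
    have h2 : 0 < Real.log (κ / 1000) := by
      by_contra! h3
      exact absurd (div_nonpos_of_nonpos_of_nonneg h3 (by linarith)) (not_le.2 h)
    have h3 : Real.log (κ / 1000) / Real.log (10 / 7) ≤ 10 / 3 * Real.log (κ / 1000) := by
      rw [div_le_iff₀ (by linarith)]
      nlinarith
    have h4 : Real.log (κ / 1000) = Real.log κ - 3 * Real.log 10 := by
      rw [Real.log_div (by linarith) (by norm_num),
        show (1000 : ℝ) = 10 ^ 3 by norm_num, Real.log_pow]
      norm_num
    linarith [one_lt_log_ten]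

/-- By minimality of the round count, each round that is run starts above 1000, as the one-step
estimate needs. -/
theorem lt_of_lt_ppcRounds {κ : ℝ} (hκ : 1 ≤ κ) {t : ℕ} (ht : t < ppcRounds κ) :
    1000 < (7 / 10 : ℝ) ^ t * κ := by
  have hl := log_ten_sevenths_ge
  have h1 : (t : ℝ) < Real.log (κ / 1000) / Real.log (10 / 7) := Nat.lt_ceil.1 ht
  rw [lt_div_iff₀ (by linarith), ← Real.log_pow,
    Real.log_lt_log_iff (by positivity) (by positivity)] at h1
  have h2 : (7 / 10 : ℝ) ^ t * (10 / 7) ^ t = 1 := by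
    rw [← mul_pow]
    norm_num
  have h3 : (0 : ℝ) < (7 / 10) ^ t := by positivity
  have h4 : (7 / 10 : ℝ) ^ t * (10 / 7) ^ t < (7 / 10) ^ t * (κ / 1000) :=
    mul_lt_mul_of_pos_left h1 h3
  linarith

theorem pow_ppcRounds_mul_le {κ : ℝ} (hκ : 1 ≤ κ) :
    (7 / 10 : ℝ) ^ ppcRounds κ * κ ≤ 1000 := by
  have hl := log_ten_sevenths_ge
  have h1 : Real.log (κ / 1000) / Real.log (10 / 7) ≤ ppcRounds κ := Nat.le_ceil _
  rw [div_le_iff₀ (by linarith), ← Real.log_pow,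
    Real.log_le_log_iff (by positivity) (by positivity)] at h1
  have h2 : (7 / 10 : ℝ) ^ ppcRounds κ * (10 / 7) ^ ppcRounds κ = 1 := by
    rw [← mul_pow]
    norm_num
  have h3 : (0 : ℝ) < (7 / 10) ^ ppcRounds κ := by positivity
  have h4 := mul_le_mul_of_nonneg_left h1 h3.le
  linarith

end rounds

/-! ### Union bound over the rounds -/

section success

open Matrix

variable {n d : ℕ}

/-- Union bound for a two-stage experiment: the first stage is bad, or the second fails given a good
first. The bad set need not be measurable. -/
theorem lintegral_le_measure_add {Ω : Type*} [MeasurableSpace Ω] {μ : Measure Ω}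
    [IsProbabilityMeasure μ] {f : Ω → ENNReal} (hf : ∀ x, f x ≤ 1) {s : Set Ω} {c : ENNReal}
    (hs : ∀ x, x ∉ s → f x ≤ c) : ∫⁻ x, f x ∂μ ≤ μ s + c := by
  calc ∫⁻ x, f x ∂μ ≤ ∫⁻ x, ((toMeasurable μ s).indicator 1 x + c) ∂μ := by
        refine lintegral_mono fun x => ?_
        by_cases hx : x ∈ toMeasurable μ s
        · rw [Set.indicator_of_mem hx]
          exact (hf x).trans le_self_add
        · exact (hs x fun h => hx (subset_toMeasurable μ s h)).trans le_add_self
    _ = μ s + c := by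
        rw [lintegral_add_right _ measurable_const,
          lintegral_indicator_one (measurableSet_toMeasurable μ s), measure_toMeasurable,
          lintegral_const, measure_univ, mul_one]

theorem measurableSet_not_formBounds (l u : ℝ) (S : Mat d) :
    MeasurableSet {B : Mat d | ¬FormBounds l u (B * S * Bᵀ)} :=
  ((isClosed_formBounds l u).preimage
    (f := fun B : Mat d => B * S * Bᵀ) (by fun_prop)).measurableSet.compl

/-- If the noise of each round is small with probability at least `1 - q`, then `t` rounds reduce
the condition number by the factor `0.7ᵗ` with probability at least `1 - t q`. -/
theorem ppcLoop_not_formBounds_le {ρ β κ : ℝ} {R S : Mat d} (hR : R.IsSymm) (hRS : R * R = S)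
    (hS : FormBounds 1 κ S) {W : Dataset n d}
    (hW : GoodSamples (1 / 300) (40 * (d * Real.log (n / β))) W) {q : ENNReal} (t : ℕ)
    (hκ : ∀ i < t, 1000 ≤ (7 / 10 : ℝ) ^ i * κ)
    (hq : ∀ κ' : ℝ, 1000 ≤ κ' → gue d (80 * (d * κ' * Real.log (n / β) / (n * Real.sqrt ρ)))
      {N | ¬(N.IsSymm ∧ FormBounds (-(κ' / 300)) (κ' / 300) N)} ≤ q) :
    ppcLoop 40 80 4 ρ β κ (transform R W) t
      {B | ¬FormBounds 1 ((7 / 10) ^ t * κ) (B * S * Bᵀ)} ≤ t * q := by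
  induction t with
  | zero =>
    rw [ppcLoop, Measure.dirac_apply' _ (measurableSet_not_formBounds _ _ _)]
    simp [hS]
  | succ t ih =>
    have hm : Measurable fun B : Mat d =>
        (weakPPC 40 80 4 ρ β ((7 / 10) ^ t * κ) (transform B (transform R W))).map
          fun A => ((11 / 10 : ℝ) • A) * B :=
      (measurable_weakPPC_map (n := n) (d := d) 40 80 4 ρ β ((7 / 10) ^ t * κ)).comp
        (measurable_prodMk_left (x := transform R W))
    have hp := (measurable_ppcLoop (n := n) (d := d) 40 80 4 ρ β κ t).2 (transform R W)
    rw [ppcLoop, Measure.bind_apply (measurableSet_not_formBounds _ _ _) hm.aemeasurable,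
      Nat.cast_succ, add_mul, one_mul]
    set κt : ℝ := (7 / 10) ^ t * κ with hκt
    have hstep : ∀ B : Mat d, Measurable
        (ppcStep 4 κt (40 * (d * κt * Real.log (n / β))) (transform R W) B) := fun B =>
      measurable_ppcStep_right _ _ _ _ _
    refine (lintegral_le_measure_add (fun B => ?_)
      (s := {B | ¬FormBounds 1 κt (B * S * Bᵀ)}) (c := q) fun B hB => ?_).trans
        (add_le_add (ih fun i hi => hκ i (by omega)) le_rfl)
    · rw [weakPPC_map_eq]
      have := Measure.isProbabilityMeasure_map (μ := gue d
        (80 * (d * κt * Real.log (n / β) / (n * Real.sqrt ρ)))) (hstep B).aemeasurable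
      exact prob_le_one
    -- Once W and B are good, only the fresh noise of this round can fail.
    · have hB' : FormBounds 1 κt (B * S * Bᵀ) := not_not.1 hB
      rw [weakPPC_map_eq, Measure.map_apply (hstep B) (measurableSet_not_formBounds _ _ _)]
      have hκ1 : 1000 ≤ κt := hκ t (Nat.lt_succ_self t)
      refine (measure_mono fun N hN hcon => ?_).trans (hq κt hκ1)
      refine hN ?_
      have := hB'.ppcStep hκ1 hR hRS hW hcon.1 hcon.2
      rw [show κt * (40 * (d * Real.log (n / β))) = 40 * (d * κt * Real.log (n / β)) by ring]
        at this
      rwa [pow_succ, mul_assoc, mul_left_comm, ← mul_assoc, mul_assoc (7 / 10 : ℝ),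
        ← hκt]

open scoped MatrixOrder in
theorem pi_multivariateGaussian_eq {S : Mat d} :
    (Measure.pi fun _ : Fin n => multivariateGaussian 0 S)
      = (Measure.pi fun _ : Fin n => stdGaussian (EuclideanSpace ℝ (Fin d))).map
        (transform (CFC.sqrt S)) := by
  have h := Measure.pi_map_pi (μ := fun _ : Fin n => stdGaussian (EuclideanSpace ℝ (Fin d)))
    (f := fun _ x => (0 : EuclideanSpace ℝ (Fin d)) + toEuclideanCLM (𝕜 := ℝ) (CFC.sqrt S) x)
    fun _ => by fun_prop
  simp only [multivariateGaussian]
  rw [← h]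
  congr 1
  funext W i
  rw [zero_add]
  rfl

end success

/-! ### Sample size arithmetic -/

section sampleSize

/-- A sample size `n ≥ C A L²` beats the logarithmic factor `log n` in the noise level. -/
theorem mul_log_le_of_le {c A L n Λ : ℝ} (hc : 3 ≤ c) (hA : 1 ≤ A) (hL : 1 ≤ L)
    (hAL : Real.log A ≤ 3 * L) (hn : (4 * c) ^ 2 * (A * L ^ 2) ≤ n)
    (hΛ : Λ ≤ Real.log n + 4 * L) : c * (A * L) * Λ ≤ n := by
  have hAL0 : 0 < A * L ^ 2 := by positivity
  -- In terms of u the claim reduces to c(2√u + 9) ≤ u, which follows from √u ≥ 4c and c ≥ 3.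
  set u := n / (A * L ^ 2) with hu
  have hun : n = u * (A * L ^ 2) := by rw [hu, div_mul_cancel₀ _ hAL0.ne']
  have hu0 : (4 * c) ^ 2 ≤ u := (le_div_iff₀ hAL0).2 hn
  have hupos : 0 < u := lt_of_lt_of_le (by positivity) hu0
  have hsq : 4 * c ≤ √u := Real.le_sqrt_of_sq_le hu0
  have hss : √u * √u = u := Real.mul_self_sqrt hupos.le
  have hlogu : Real.log u ≤ 2 * √u := by
    have h1 := Real.log_le_self (Real.sqrt_nonneg u)
    rw [Real.log_sqrt hupos.le] at h1
    linarith
  have hlogu0 : 0 ≤ Real.log u := Real.log_nonneg (by nlinarith)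
  have hlogL : Real.log L ≤ L := Real.log_le_self (by linarith)
  have hlogn : Real.log n ≤ Real.log u + 5 * L := by
    rw [hun, Real.log_mul hupos.ne' hAL0.ne', Real.log_mul (by positivity) (by positivity),
      Real.log_pow]
    push_cast
    linarith
  have hΛ' : Λ ≤ (2 * √u + 9) * L := by nlinarith
  calc c * (A * L) * Λ ≤ c * (A * L) * ((2 * √u + 9) * L) := by gcongr
    _ = c * (2 * √u + 9) * (A * L ^ 2) := by ring
    _ ≤ u * (A * L ^ 2) := by
        gcongr
        nlinarith
    _ = n := hun.symm

/-- The sample size of the preconditioning theorem suffices for every union bound. -/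
theorem sampleSize_bounds {D ε β ℓ T n : ℝ} (hD : 1 ≤ D) (hε : 0 < ε) (hεD : ε ≤ √D) (hβ : 0 < β)
    (hβ1 : β < 1) (hℓ : 1 ≤ ℓ) (hT : 1 ≤ T) (hTℓ : T ≤ 4 * ℓ)
    (hn : 256 * 10 ^ 12 * (D ^ (3 / 2 : ℝ) * √ℓ / ε) *
      Real.log (Real.exp 1 + D + 1 / ε + ℓ + 1 / β) ^ 2 ≤ n) :
    10 ^ 9 * (D + Real.log (1 / β) + 1) ≤ n ∧
      64 * 48000 ^ 2 * (D * Real.log (n / (β / T))) ^ 2 * (4 * D + Real.log (8 / (β / T)))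
        ≤ n ^ 2 * (ε ^ 2 / 2 / T) := by
  set L := Real.log (Real.exp 1 + D + 1 / ε + ℓ + 1 / β) with hL
  set A := D ^ (3 / 2 : ℝ) * √ℓ / ε with hA
  have he := Real.exp_pos 1
  have hε' : 0 < 1 / ε := by positivity
  have hβ' : 0 < 1 / β := by positivity
  have hD0 : 0 < D := by linarith
  have hL1 : 1 ≤ L := by
    rw [hL, Real.le_log_iff_exp_le (by positivity)]
    linarith
  have hlogD : Real.log D ≤ L := Real.log_le_log hD0 (by linarith)
  have hlogε : Real.log (1 / ε) ≤ L := Real.log_le_log hε' (by linarith)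
  have hlogℓ : Real.log ℓ ≤ L := Real.log_le_log (by linarith) (by linarith)
  have hlogβ : Real.log (1 / β) ≤ L := Real.log_le_log hβ' (by linarith)
  have hlogβ0 : 0 ≤ Real.log (1 / β) := Real.log_nonneg ((one_le_div hβ).2 hβ1.le)
  have hD32 : D ^ (3 / 2 : ℝ) = D * √D := by
    rw [Real.sqrt_eq_rpow, ← Real.rpow_one_add' hD0.le (by norm_num)]
    norm_num
  have hsD : 1 ≤ √D := Real.one_le_sqrt.2 hD
  have hsℓ : 1 ≤ √ℓ := Real.one_le_sqrt.2 hℓ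
  -- Here ε ≤ √D enters: the private sample size then also dominates the D samples that covariance
  -- estimation needs.
  have hAD : D ≤ A := by
    rw [hA, hD32, le_div_iff₀ hε]
    calc D * ε ≤ D * √D := by gcongr
      _ ≤ D * √D * √ℓ := le_mul_of_one_le_right (by positivity) hsℓ
  have hA1 : 1 ≤ A := hD.trans hAD
  have hlogA : Real.log A ≤ 3 * L := by
    have h1 : A = D ^ (3 / 2 : ℝ) * √ℓ * (1 / ε) := by rw [hA]; ring
    rw [h1, Real.log_mul (by positivity) (by positivity),
      Real.log_mul (by positivity) (by positivity), Real.log_rpow hD0,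
      Real.log_sqrt (by linarith)]
    linarith
  have hn' : 256 * 10 ^ 12 * (A * L ^ 2) ≤ n := by linarith
  have hDAL : D ≤ A * L ^ 2 := by nlinarith [one_le_pow₀ (n := 2) hL1]
  have hLAL : L ≤ A * L ^ 2 := by nlinarith
  have hn0 : 0 < n := by linarith
  have h1 : 10 ^ 9 * (D + Real.log (1 / β) + 1) ≤ n := by linarith
  refine ⟨h1, ?_⟩
  have hlog4 : Real.log 4 ≤ 2 := by
    rw [show (4 : ℝ) = 2 ^ 2 by norm_num, Real.log_pow]
    push_cast
    linarith [Real.log_two_lt_d9]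
  have hlog8 : Real.log 8 ≤ 3 := by
    rw [show (8 : ℝ) = 2 ^ 3 by norm_num, Real.log_pow]
    push_cast
    linarith [Real.log_two_lt_d9]
  have hlogT : Real.log T ≤ 3 * L := by
    have h2 := Real.log_le_log (by linarith) hTℓ
    rw [Real.log_mul (by norm_num) (by linarith)] at h2
    linarith
  have hdiv : ∀ x : ℝ, 0 < x → Real.log (x / (β / T))
      = Real.log x + Real.log T + Real.log (1 / β) := by
    intro x hx
    rw [show x / (β / T) = x * T * (1 / β) by field_simp, Real.log_mul (by positivity)
      (by positivity), Real.log_mul (by positivity) (by positivity)]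
  have hΛ : Real.log (n / (β / T)) ≤ Real.log n + 4 * L := by
    rw [hdiv n hn0]
    linarith
  have hΛ0 : 0 ≤ Real.log (n / (β / T)) := by
    rw [hdiv n hn0]
    have := Real.log_nonneg (show 1 ≤ n by linarith)
    linarith [Real.log_nonneg hT]
  have h8 : Real.log (8 / (β / T)) ≤ 7 * L := by
    rw [hdiv 8 (by norm_num)]
    linarith
  set Λ := Real.log (n / (β / T)) with hΛdef
  -- (4·4·10⁶)² = 256·10¹² is the constant of the sample size, and (4·10⁶)² exceeds 64·48000²·88
  -- below.
  have hkey := mul_log_le_of_le (c := 4 * 10 ^ 6) (by norm_num) hA1 hL1 hlogA (by linarith) hΛ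
  have hkey2 : (4 * 10 ^ 6 * (A * L) * Λ) ^ 2 ≤ n ^ 2 := by gcongr
  have hAε : (A * ε) ^ 2 = D ^ 3 * ℓ := by
    rw [hA, div_mul_cancel₀ _ hε.ne', hD32, mul_pow, mul_pow, Real.sq_sqrt hD0.le,
      Real.sq_sqrt (by linarith)]
    ring
  have hDL : 4 * D + Real.log (8 / (β / T)) ≤ 11 * (D * L ^ 2) := by
    have hLL : L ≤ L ^ 2 := by nlinarith
    have hDD : D ≤ D * L ^ 2 := le_mul_of_one_le_right hD0.le (by linarith)
    have hLD : L ^ 2 ≤ D * L ^ 2 := le_mul_of_one_le_left (by positivity) hD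
    linarith
  rw [div_div, ← mul_div_assoc, le_div_iff₀ (by positivity)]
  calc 64 * 48000 ^ 2 * (D * Λ) ^ 2 * (4 * D + Real.log (8 / (β / T))) * (2 * T)
      ≤ 64 * 48000 ^ 2 * (D * Λ) ^ 2 * (11 * (D * L ^ 2)) * (2 * (4 * ℓ)) := by gcongr
    _ = 64 * 48000 ^ 2 * 88 * (D ^ 3 * ℓ) * (L * Λ) ^ 2 := by ring
    _ ≤ (4 * 10 ^ 6) ^ 2 * (D ^ 3 * ℓ) * (L * Λ) ^ 2 := by
        gcongr
        norm_num
    _ = (4 * 10 ^ 6 * (A * L) * Λ) ^ 2 * ε ^ 2 := by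
        rw [← hAε]
        ring
    _ ≤ n ^ 2 * ε ^ 2 := by gcongr

end sampleSize

/-! ### Assembling the probability bounds -/

section final

open Matrix

variable {n d : ℕ}

theorem twentyFive_pow_le_exp (d : ℕ) : (25 : ℝ) ^ d ≤ Real.exp (4 * d) := by
  have h1 : (25 : ℝ) ≤ Real.exp 4 := by
    have h2 : Real.exp 4 = Real.exp 1 ^ 4 := by rw [← Real.exp_nat_mul]; norm_num
    have h3 : (2.7 : ℝ) ^ 4 ≤ Real.exp 1 ^ 4 :=
      pow_le_pow_left₀ (by norm_num) (by linarith [Real.exp_one_gt_d9]) 4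
    rw [h2]
    norm_num at h3 ⊢
    linarith
  calc (25 : ℝ) ^ d ≤ Real.exp 4 ^ d := by gcongr
    _ = Real.exp (4 * d) := by rw [← Real.exp_nat_mul, mul_comm]

theorem exp_neg_log_one_div {β : ℝ} (hβ : 0 < β) : Real.exp (-Real.log (1 / β)) = β := by
  rw [one_div, Real.log_inv, neg_neg, Real.exp_log hβ]

theorem stdGaussian_not_goodSamples_le_of_sampleSize {β T : ℝ} (hd : 1 ≤ d) (hβ : 0 < β)
    (hβ1 : β < 1) (hT : 1 ≤ T) (hn : 10 ^ 9 * ((d : ℝ) + Real.log (1 / β) + 1) ≤ n) :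
    (Measure.pi fun _ : Fin n => stdGaussian (EuclideanSpace ℝ (Fin d)))
        {W | ¬GoodSamples (1 / 300) (40 * (d * Real.log (n / (β / T)))) W}
      ≤ ENNReal.ofReal (β / 2) := by
  have hd' : (1 : ℝ) ≤ d := by exact_mod_cast hd
  have hlogβ : 0 ≤ Real.log (1 / β) := Real.log_nonneg ((one_le_div hβ).2 hβ1.le)
  have hn4 : (4 : ℝ) ≤ n := by linarith
  have hn0 : 0 < n := by exact_mod_cast (show (0 : ℝ) < n by linarith)
  have h := stdGaussian_not_goodSamples_le (d := d) hn0 (m := 1 / 600) (by norm_num) (by norm_num)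
    (40 * (d * Real.log (n / (β / T))))
  rw [show 2 * (1 / 600 : ℝ) = 1 / 300 by norm_num] at h
  refine h.trans ?_
  rw [← ENNReal.ofReal_add (by positivity) (by positivity)]
  refine ENNReal.ofReal_le_ofReal ?_
  -- 10⁹ exceeds 4·600²·256, so the exponent beats the 4d of the net, log(1/β) and a constant.
  have h1 : 4 * 25 ^ d * Real.exp (-(n * (1 / 600 : ℝ) ^ 2 / 256)) ≤ β / 4 := by
    have h2 : Real.exp (-(n * (1 / 600 : ℝ) ^ 2 / 256))
        ≤ Real.exp (-(4 * d)) * Real.exp (-3) * Real.exp (-Real.log (1 / β)) := by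
      rw [← Real.exp_add, ← Real.exp_add, Real.exp_le_exp]
      linarith
    have h3 : Real.exp (-3) ≤ 1 / 16 := by
      have h4 : Real.exp (-3) = (Real.exp 1 ^ 3)⁻¹ := by
        rw [← Real.exp_nat_mul, ← Real.exp_neg]
        norm_num
      have h5 : (2.7 : ℝ) ^ 3 ≤ Real.exp 1 ^ 3 :=
        pow_le_pow_left₀ (by norm_num) (by linarith [Real.exp_one_gt_d9]) 3
      rw [h4, one_div]
      refine inv_anti₀ (by norm_num) ?_
      norm_num at h5 ⊢
      linarith
    rw [exp_neg_log_one_div hβ] at h2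
    calc 4 * 25 ^ d * Real.exp (-(n * (1 / 600 : ℝ) ^ 2 / 256))
        ≤ 4 * Real.exp (4 * d) * (Real.exp (-(4 * d)) * (1 / 16) * β) := by
          refine mul_le_mul ?_ (h2.trans ?_) (Real.exp_pos _).le (by positivity)
          · gcongr
            exact twentyFive_pow_le_exp d
          · gcongr
      _ = (Real.exp (4 * d) * Real.exp (-(4 * d))) * (β / 4) := by ring
      _ = β / 4 := by rw [← Real.exp_add, add_neg_cancel, Real.exp_zero, one_mul]
  -- The factor 40 makes the exponential at most β/n²: one n pays for the union over samples, the
  -- other for the constant 1/4.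
  have h2 : n * Real.exp (d / 2 - 40 * (d * Real.log (n / (β / T))) / 4) ≤ β / 4 := by
    have hlogn : 1 ≤ Real.log n := by
      rw [Real.le_log_iff_exp_le (by linarith)]
      linarith [Real.exp_one_lt_d9]
    have hΛ : Real.log n + Real.log (1 / β) ≤ Real.log (n / (β / T)) := by
      rw [← Real.log_mul (by linarith) (by positivity), mul_one_div]
      refine Real.log_le_log (by positivity) ?_
      gcongr
      exact div_le_self hβ.le hT
    set Λ := Real.log (n / (β / T)) with hΛdef
    have hdΛ : Λ ≤ d * Λ := le_mul_of_one_le_left (by linarith) hd'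
    have hdΛ' : (d : ℝ) ≤ d * Λ := le_mul_of_one_le_right (by linarith) (by linarith)
    have h3 : (d : ℝ) / 2 - 40 * (d * Λ) / 4 ≤ -Real.log n + (-Real.log n + -Real.log (1 / β)) := by
      linarith
    have hexp : Real.exp (-Real.log n) = (n : ℝ)⁻¹ := by
      rw [Real.exp_neg, Real.exp_log (by linarith)]
    calc n * Real.exp (d / 2 - 40 * (d * Λ) / 4)
        ≤ n * Real.exp (-Real.log n + (-Real.log n + -Real.log (1 / β))) := by gcongr
      _ = β / n := by
          rw [Real.exp_add, Real.exp_add, hexp, exp_neg_log_one_div hβ]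
          field_simp
      _ ≤ β / 4 := by gcongr
  linarith

theorem gue_not_formBounds_le_of_sampleSize {ρ β κ : ℝ} (hd : 1 ≤ d) (hn : 2 ≤ n) (hρ : 0 < ρ)
    (hβ : 0 < β) (hβ1 : β < 1) (hκ : 0 < κ)
    (h : 64 * 48000 ^ 2 * (d * Real.log (n / β)) ^ 2 * (4 * d + Real.log (8 / β)) ≤ n ^ 2 * ρ) :
    gue d (80 * (d * κ * Real.log (n / β) / (n * Real.sqrt ρ)))
        {N | ¬(N.IsSymm ∧ FormBounds (-(κ / 300)) (κ / 300) N)}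
      ≤ ENNReal.ofReal (β / 2) := by
  have hd' : (0 : ℝ) < d := by exact_mod_cast hd
  have hn' : (2 : ℝ) ≤ n := by exact_mod_cast hn
  have hlog : 0 < Real.log (n / β) := Real.log_pos ((one_lt_div hβ).2 (by linarith))
  set s := 80 * (d * κ * Real.log (n / β) / (n * Real.sqrt ρ)) with hs
  have hs0 : 0 < s := by positivity
  have hg := gue_not_formBounds_le (d := d) hs0.ne' (m := κ / 600) (by positivity)
  rw [show 2 * (κ / 600) = κ / 300 by ring] at hg
  refine hg.trans (ENNReal.ofReal_le_ofReal ?_)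
  have hs2 : s ^ 2 * (n ^ 2 * ρ) = (80 * (d * κ * Real.log (n / β))) ^ 2 := by
    have : √ρ ^ 2 = ρ := Real.sq_sqrt hρ.le
    rw [hs]
    field_simp
    rw [this]
  -- Both sides of the noise comparison scale with κ, which cancels; 48000 = 80·600.
  have hexp : 4 * d + Real.log (8 / β) ≤ (κ / 600) ^ 2 / (64 * s ^ 2) := by
    rw [le_div_iff₀ (by positivity)]
    have hnρ : 0 < n ^ 2 * ρ := by positivity
    refine le_of_mul_le_mul_right ?_ hnρ
    calc (4 * d + Real.log (8 / β)) * (64 * s ^ 2) * (n ^ 2 * ρ)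
        = (4 * d + Real.log (8 / β)) * 64 * (s ^ 2 * (n ^ 2 * ρ)) := by ring
      _ = (κ / 600) ^ 2 *
          (64 * 48000 ^ 2 * (d * Real.log (n / β)) ^ 2 * (4 * d + Real.log (8 / β))) := by
          rw [hs2]
          ring
      _ ≤ (κ / 600) ^ 2 * (n ^ 2 * ρ) := by gcongr
  calc 4 * 25 ^ d * Real.exp (-((κ / 600) ^ 2 / (64 * s ^ 2)))
      ≤ 4 * Real.exp (4 * d) * Real.exp (-(4 * d + Real.log (8 / β))) := by
        gcongr
        exact twentyFive_pow_le_exp d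
    _ = β / 2 := by
        rw [mul_assoc, ← Real.exp_add, neg_add, add_neg_cancel_left, Real.exp_neg,
          Real.exp_log (by positivity)]
        field_simp
        norm_num

theorem ppc_not_isPreconditioner_le {ρ β κ : ℝ} {S : Mat d} (hS : S.IsSymm) (hκ : 1 ≤ κ)
    {X : Dataset n d} {c : ENNReal}
    (h : ppcLoop 40 80 4 (ρ / ppcRounds κ) (β / ppcRounds κ) κ X (ppcRounds κ)
      {B | ¬FormBounds 1 ((7 / 10) ^ ppcRounds κ * κ) (B * S * Bᵀ)} ≤ c) :
    ppcKernel 40 80 4 ρ β κ X {A | ¬IsPreconditioner S A} ≤ c := by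
  refine le_trans ?_ h
  have hmeas : MeasurableSet {A : Mat d | ¬IsPreconditioner S A} :=
    (isClosed_isPreconditioner hS).measurableSet.compl
  change (Measure.map _ _) _ ≤ _
  rw [Measure.map_apply measurable_polarFactor hmeas]
  exact measure_mono fun B hB hcon => hB (isPreconditioner_polarFactor hS
    (hcon.mono le_rfl (pow_ppcRounds_mul_le hκ)))

open scoped MatrixOrder in
theorem ppcKernel_not_isPreconditioner_le {ε β κ : ℝ} (hε : 0 < ε) (hβ : 0 < β) (hβ1 : β < 1)
    (hκ : 1 ≤ κ) (hεd : ε ≤ Real.sqrt d)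
    (hn : 256 * 10 ^ 12 * ((d : ℝ) ^ (3 / 2 : ℝ) * Real.sqrt (Real.log κ) / ε) *
      Real.log (Real.exp 1 + d + 1 / ε + Real.log κ + 1 / β) ^ 2 ≤ (n : ℝ))
    {S : Mat d} (hS1 : (S - 1).PosSemidef) (hSκ : (κ • (1 : Mat d) - S).PosSemidef) :
    ((Measure.pi fun _ : Fin n => multivariateGaussian 0 S).bind
      (ppcKernel 40 80 4 (ε ^ 2 / 2) β κ)) {A | ¬IsPreconditioner S A} ≤ ENNReal.ofReal β := by
  have hS : S.IsSymm := by
    have := (isSymm_iff_isSelfAdjoint.2 hS1.1).add (Matrix.isSymm_one (n := Fin d) (α := ℝ))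
    rwa [sub_add_cancel] at this
  have hSF : FormBounds 1 κ S := (formBounds_iff_posSemidef hS 1 κ).2 ⟨by rwa [one_smul], hSκ⟩
  have hd : 1 ≤ d := by
    rcases Nat.eq_zero_or_pos d with rfl | h
    · simp only [Nat.cast_zero, Real.sqrt_zero] at hεd
      linarith
    · exact h
  have hmeas : MeasurableSet {A : Mat d | ¬IsPreconditioner S A} :=
    (isClosed_isPreconditioner hS).measurableSet.compl
  rw [Measure.bind_apply hmeas (Kernel.measurable _).aemeasurable]
  -- Without rounds the output comes from B = 1 and succeeds surely; β/T would be meaningless here.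
  by_cases hT0 : ppcRounds κ = 0
  · have h0 : ∀ X : Dataset n d,
        ppcKernel 40 80 4 (ε ^ 2 / 2) β κ X {A | ¬IsPreconditioner S A} ≤ 0 := fun X => by
      refine ppc_not_isPreconditioner_le hS hκ ?_
      rw [hT0, ppcLoop, Measure.dirac_apply' _ (measurableSet_not_formBounds _ _ _)]
      simp [hSF]
    calc _ ≤ ∫⁻ _, 0 ∂(Measure.pi fun _ : Fin n => multivariateGaussian 0 S) := lintegral_mono h0
      _ ≤ _ := by simp
  have hT1 : (1 : ℝ) ≤ ppcRounds κ := by exact_mod_cast Nat.one_le_iff_ne_zero.2 hT0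
  have hκ1000 : 1000 < κ := by
    simpa using lt_of_lt_ppcRounds hκ (t := 0) (Nat.pos_of_ne_zero hT0)
  have hℓ : 1 ≤ Real.log κ := one_lt_log_ten.le.trans (Real.log_le_log (by norm_num) (by linarith))
  have hd' : (1 : ℝ) ≤ d := by exact_mod_cast hd
  obtain ⟨hn1, hn2⟩ := sampleSize_bounds hd' hε hεd hβ hβ1 hℓ hT1 (ppcRounds_le hκ) hn
  have hlogβ : 0 ≤ Real.log (1 / β) := Real.log_nonneg ((one_le_div hβ).2 hβ1.le)
  have hn2' : 2 ≤ n := by exact_mod_cast (show (2 : ℝ) ≤ n by linarith)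
  set T := ppcRounds κ with hT
  set R : Mat d := CFC.sqrt S with hR
  have hSpsd : S.PosSemidef := by
    have := hS1.add (Matrix.PosSemidef.one (n := Fin d) (R := ℝ))
    rwa [sub_add_cancel] at this
  have hRs : R.IsSymm := isSymm_iff_isSelfAdjoint.2 (CFC.sqrt_nonneg S).isSelfAdjoint
  have hRR : R * R = S := CFC.sqrt_mul_sqrt_self S hSpsd.nonneg
  have htr : Measurable (transform (n := n) R) :=
    measurable_transform.comp (measurable_prodMk_left (x := R))
  rw [pi_multivariateGaussian_eq, lintegral_map (Kernel.measurable_coe _ hmeas) htr]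
  have hbound := lintegral_le_measure_add
    (μ := Measure.pi fun _ : Fin n => stdGaussian (EuclideanSpace ℝ (Fin d)))
    (f := fun W => ppcKernel 40 80 4 (ε ^ 2 / 2) β κ (transform R W) {A | ¬IsPreconditioner S A})
    (fun W => prob_le_one (μ := ppcKernel 40 80 4 (ε ^ 2 / 2) β κ (transform R W)))
    (s := {W | ¬GoodSamples (1 / 300) (40 * (d * Real.log (n / (β / T)))) W})
    (c := T * ENNReal.ofReal (β / T / 2)) fun W hW => by
      refine ppc_not_isPreconditioner_le hS hκ ?_
      refine ppcLoop_not_formBounds_le hRs hRR hSF (not_not.1 hW) _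
        (fun i hi => (lt_of_lt_ppcRounds hκ hi).le) fun κ' hκ' => ?_
      exact gue_not_formBounds_le_of_sampleSize hd hn2' (by positivity) (by positivity)
        ((div_le_self hβ.le hT1).trans_lt hβ1) (by linarith) hn2
  refine hbound.trans ?_
  have hW := stdGaussian_not_goodSamples_le_of_sampleSize (n := n) hd hβ hβ1 hT1 hn1
  have hTq : (T : ENNReal) * ENNReal.ofReal (β / T / 2) = ENNReal.ofReal (β / 2) := by
    rw [← ENNReal.ofReal_natCast, ← ENNReal.ofReal_mul (by positivity)]
    congr 1
    field_simp
  rw [hTq]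
  refine (add_le_add hW le_rfl).trans (le_of_eq ?_)
  rw [← ENNReal.ofReal_add (by positivity) (by positivity), add_halves]

end final

end
theorem theorem1p2 :
    ∃ (a b K : ℝ) (C : ℝ) (c : ℕ), 0 < a ∧ 0 < b ∧ 0 < K ∧ 0 < C ∧
      (∀ κ : ℝ, 1 ≤ κ → (ppcRounds κ : ℝ) ≤ C * Real.log κ) ∧
      ∀ (d n : ℕ) (ε β κ : ℝ), 0 < ε → 0 < β → β < 1 → 1 ≤ κ →
        ∃ M : Kernel (Dataset n d) (Mat d),
          IsMarkovKernel M ∧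
          (∀ X : Dataset n d, M X = ppc a b K (ε ^ 2 / 2) β κ X) ∧
          IsZCDP M (ε ^ 2 / 2) ∧
          (ε ≤ Real.sqrt d →
            C * ((d : ℝ) ^ (3 / 2 : ℝ) * Real.sqrt (Real.log κ) / ε) *
                Real.log (Real.exp 1 + d + 1 / ε + Real.log κ + 1 / β) ^ c ≤ (n : ℝ) →
            ∀ S : Mat d, (S - 1).PosSemidef → (κ • (1 : Mat d) - S).PosSemidef →
              ENNReal.ofReal (1 - β) ≤
                ((Measure.pi fun _ : Fin n => multivariateGaussian 0 S).bind M)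
                  {A | IsPreconditioner S A}) := by
  -- b = 2a is the least value the privacy proof accepts, and K = 4 halves the large directions.
  refine ⟨40, 80, 4, 256 * 10 ^ 12, 2, by norm_num, by norm_num, by norm_num, by norm_num,
    fun κ hκ => (ppcRounds_le hκ).trans ?_, fun d n ε β κ hε hβ hβ1 hκ =>
    ⟨ppcKernel 40 80 4 (ε ^ 2 / 2) β κ, inferInstance, fun X => rfl,
      isZCDP_ppcKernel (by norm_num) (by norm_num) (by positivity) (by linarith) hβ hβ1,
      fun hεd hn S hS1 hSκ => ?_⟩⟩
  · have := Real.log_nonneg hκ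
    gcongr
    norm_num
  · have hS : S.IsSymm := by
      have := (isSymm_iff_isSelfAdjoint.2 hS1.1).add (Matrix.isSymm_one (n := Fin d) (α := ℝ))
      rwa [sub_add_cancel] at this
    have hmeas := (isClosed_isPreconditioner hS).measurableSet
    have hbad := ppcKernel_not_isPreconditioner_le hε hβ hβ1 hκ hεd hn hS1 hSκ
    have hprob : IsProbabilityMeasure ((Measure.pi fun _ : Fin n => multivariateGaussian 0 S).bind
        (ppcKernel 40 80 4 (ε ^ 2 / 2) β κ)) :=
      isProbabilityMeasure_bind (Kernel.measurable _).aemeasurable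
        (Filter.Eventually.of_forall fun X => IsMarkovKernel.isProbabilityMeasure X)
    rw [ENNReal.ofReal_sub _ hβ.le, ENNReal.ofReal_one, tsub_le_iff_right,
      ← prob_add_prob_compl (μ := (Measure.pi fun _ : Fin n => multivariateGaussian 0 S).bind
        (ppcKernel 40 80 4 (ε ^ 2 / 2) β κ)) hmeas]
    exact add_le_add le_rfl hbad
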